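/- Let $X=(x_1,\dots,x_n)$ be a configuration of $n$ distinct points in $\mathbb{R}^d$ whose convex hull $P$ has dimension $d$. For $y\in\mathbb{R}^n$ and $t\in P$ let the tent function $h_{X,y}(t)$ be the largest real $s$ with $(t,s)\in\mathrm{conv}\{(x_1,y_1),\dots,(x_n,y_n)\}$, and let $f_{X,y}=\exp(h_{X,y})$ on $P$ and $f_{X,y}=0$ off $P$. Call $y$ relevant if $h_{X,y}(x_i)=y_i$ for all $i$. The regular subdivision induced by $y$ has as cells the sets $C\subseteq\{1,\dots,n\}$ such that $\mathrm{conv}(x_i:i\in C)$ is a region of linearity of $h_{X,y}$ (a set with non-empty interior of the form $\{t\in P: h_{X,y}(t)=\ell(t)\}$ with $\ell$ affine) and $C$ consists of all $i$ such that $x_i$ lies in that region and $h_{X,y}(x_i)=y_i$. A regular triangulation is a regular subdivision, induced by some vector in $\mathbb{R}^n$, all of whose cells are affinely independent. It refines a subdivision if each of its cells is contained in a cell of that subdivision, and it uses $x_k$ if $k$ belongs to one of its cells. For $\sigma\subseteq\{1,\dots,n\}$ let $\mathrm{vol}(\sigma)$ be $d!$ times the Lebesgue measure of $\mathrm{conv}(x_i:i\in\sigma)$.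 Let $H:\mathbb{R}^d\to\mathbb{R}$ be the continuous extension of $$H(u_1,\dots,u_d)=(-1)^d\,\frac{1+u_1^{-1}+\cdots+u_d^{-1}}{u_1u_2\cdots u_d}+\sum_{j=1}^d\frac{e^{u_j}}{u_j^2\prod_{k\ne j}(u_j-u_k)}$$ from the vectors with nonzero, pairwise distinct coordinates to all of $\mathbb{R}^d$. For a weight vector $w\in\mathbb{R}^n_{\ge 0}$ consider three problems: (1) maximize $\sum_i w_i\log f(x_i)$ over all integrable $f:\mathbb{R}^d\to\mathbb{R}_{\ge0}$ with $\log f:\mathbb{R}^d\to\mathbb{R}\cup\{-\infty\}$ concave and $\int_{\mathbb{R}^d} f(t)\,dt=1$ (with $0\cdot(-\infty)=0$); (2) maximize $w\cdot y$ over all $y\in\mathbb{R}^n$ with $\int_P\exp(h_{X,y}(t))\,dt\le1$; (3) maximize $w\cdot y-\int_P\exp(h_{X,y}(t))\,dt$ over all $y\in\mathbb{R}^n$. Say that $y^*$ is the optimal solution for $w$ if $f_{X,y^*}$ is the unique maximizer in (1) and $y^*$ is the unique maximizer in (2) and in (3). Let $y^*\in\mathbb{R}^n$ be relevant with $\int_{\mathbb{R}^d}f_{X,y^*}(t)\,dt=1$.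 Then: (a) There is $w\in\mathbb{R}^n_{>0}$ with $\sum_k w_k=1$ such that $y^*$ is the optimal solution for $w$. (b) There is a regular triangulation that refines the subdivision induced by $y^*$ and uses every point of $X$. (c) Let $\Delta$ be any regular triangulation that refines the subdivision induced by $y^*$, and put $$w_k=\sum_{\sigma\in\Delta,\ k\in\sigma}\mathrm{vol}(\sigma)\,e^{y^*_k}\,H\bigl(y^*_i-y^*_k : i\in\sigma\setminus k\bigr),\qquad k=1,\dots,n.$$ Then $w_k\ge0$ for all $k$, with $w_k>0$ if and only if $\Delta$ uses $x_k$; $\sum_k w_k=1$; $f_{X,y^*}$ is the unique maximizer in (1); and $y^*$ is a maximizer in (2) and in (3). If $\Delta$ uses every point of $X$, then $w\in\mathbb{R}^n_{>0}$ and $y^*$ is the optimal solution for $w$. -/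

import Mathlib

open MeasureTheory Set

namespace LogConcaveMLE

/-- `ℝ^d`, with Lebesgue measure as `volume`. -/
abbrev Pt (d : ℕ) : Type := EuclideanSpace ℝ (Fin d)

noncomputable section

/-! ### Tent functions -/

/-- The polytope `P = conv(x_1, …, x_n)`. -/
def hull {d n : ℕ} (x : Fin n → Pt d) : Set (Pt d) :=
  convexHull ℝ (range x)

/-- The tent function `h_{X,y}` on `P`: the largest real `s` such that `(t, s)` lies in the convex
hull of the lifted points `(x_i, y_i)`. For `t ∉ P`, where `h_{X,y}(t) = -∞`, the value is
a dummy and is never used. -/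
def tent {d n : ℕ} (x : Fin n → Pt d) (y : Fin n → ℝ) (t : Pt d) : ℝ :=
  sSup {s : ℝ | (t, s) ∈ convexHull ℝ (range fun i => (x i, y i))}

/-- `y` is relevant: every `(x_i, y_i)` is a tent pole. -/
def IsRelevant {d n : ℕ} (x : Fin n → Pt d) (y : Fin n → ℝ) : Prop :=
  ∀ i, tent x y (x i) = y i

/-- `f_{X,y}`, equal to `exp(h_{X,y})` on `P` and to `0` elsewhere. -/
def tentDensity {d n : ℕ} (x : Fin n → Pt d) (y : Fin n → ℝ) : Pt d → ℝ :=
  (hull x).indicator fun t => Real.exp (tent x y t)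

/-! ### Regular subdivisions and triangulations -/

/-- `C` is (the index set of) a cell of the regular subdivision of `X` induced by `y`: the
convex hull of the points labeled by `C` is a `d`-dimensional region of linearity of `h_{X,y}`,
i.e. the full locus in `P` where `h_{X,y}` agrees with some affine function, and `C` consists of
the labels of all tent poles in that region. -/
def IsCell {d n : ℕ} (x : Fin n → Pt d) (y : Fin n → ℝ) (C : Finset (Fin n)) : Prop :=
  (interior (convexHull ℝ (x '' (C : Set (Fin n))))).Nonempty ∧
  (∃ l : Pt d →ᵃ[ℝ] ℝ,
    convexHull ℝ (x '' (C : Set (Fin n))) = {t | t ∈ hull x ∧ tent x y t = l t}) ∧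
  ∀ i, i ∈ C ↔ x i ∈ convexHull ℝ (x '' (C : Set (Fin n))) ∧ tent x y (x i) = y i

open Classical in
/-- The regular subdivision of `X` induced by `y`, as the collection of its cells. -/
def regularSubdivision {d n : ℕ} (x : Fin n → Pt d) (y : Fin n → ℝ) :
    Finset (Finset (Fin n)) :=
  Finset.univ.filter fun C => IsCell x y C

/-- A regular triangulation: a regular subdivision all of whose cells are simplices
(they are `d`-dimensional by the definition of a cell). -/
def IsRegularTriangulation {d n : ℕ} (x : Fin n → Pt d) (Δ : Finset (Finset (Fin n))) : Prop :=
  (∃ z : Fin n → ℝ, Δ = regularSubdivision x z) ∧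
  ∀ σ ∈ Δ, AffineIndependent ℝ fun i : {i // i ∈ σ} => x i

/-- `Δ` refines `Γ`: every cell of `Δ` is contained in a cell of `Γ`. -/
def Refines {n : ℕ} (Δ Γ : Finset (Finset (Fin n))) : Prop :=
  ∀ σ ∈ Δ, ∃ C ∈ Γ, σ ⊆ C

/-- The normalized volume `d! · λ(conv(x_i : i ∈ σ))`, so that a unimodular simplex has
volume `1`. -/
def normVol {d n : ℕ} (x : Fin n → Pt d) (σ : Finset (Fin n)) : ℝ :=
  (d.factorial : ℝ) * volume.real (convexHull ℝ (x '' (σ : Set (Fin n))))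

/-! ### The symmetric function `H` and the weights -/

/-- The closed formula for `H`, meaningful where the `u_j` are nonzero and pairwise distinct. -/
def HFormula {ι : Type} [Fintype ι] [DecidableEq ι] (u : ι → ℝ) : ℝ :=
  (-1) ^ Fintype.card ι * ((1 + ∑ j, (u j)⁻¹) / ∏ j, u j) +
    ∑ j, Real.exp (u j) / ((u j) ^ 2 * ∏ k ∈ Finset.univ.erase j, (u j - u k))

/-- The function `H`: the extension by continuity of the closed formula from the dense set of
vectors with nonzero, pairwise distinct coordinates to the whole space. -/
def H {ι : Type} [Fintype ι] [DecidableEq ι] : (ι → ℝ) → ℝ :=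
  extendFrom {u : ι → ℝ | (∀ j, u j ≠ 0) ∧ Function.Injective u} HFormula

/-- `w_k = ∑_{σ ∈ Δ, k ∈ σ} vol(σ) exp(y_k) H(y_i - y_k : i ∈ σ \ k)`. -/
def weight {d n : ℕ} (x : Fin n → Pt d) (y : Fin n → ℝ) (Δ : Finset (Finset (Fin n)))
    (k : Fin n) : ℝ :=
  ∑ σ ∈ Δ with k ∈ σ,
    normVol x σ * Real.exp (y k) * H fun i : {i // i ∈ σ.erase k} => y i - y k

/-! ### The optimization problems -/

/-- `a` maximizes `F` over `S`. -/
def IsMaximizer {α β : Type*} [Preorder β] (F : α → β) (S : Set α) (a : α) : Prop :=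
  a ∈ S ∧ ∀ b ∈ S, F b ≤ F a

/-- `a` is the unique maximizer of `F` over `S`. -/
def IsUniqueMaximizer {α β : Type*} [Preorder β] (F : α → β) (S : Set α) (a : α) : Prop :=
  a ∈ S ∧ ∀ b ∈ S, b ≠ a → F b < F a

/-- `log f(t) ∈ ℝ ∪ {-∞}` for a nonnegative function `f`, with `log 0 = -∞`. -/
def extLog {d : ℕ} (f : Pt d → ℝ) (t : Pt d) : EReal :=
  ENNReal.log (ENNReal.ofReal (f t))

/-- `log f` is a concave function with values in `ℝ ∪ {-∞}` (with `0 · (-∞) = 0`). -/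
def IsLogConcave {d : ℕ} (f : Pt d → ℝ) : Prop :=
  ∀ (s t : Pt d) (a b : ℝ), 0 ≤ a → 0 ≤ b → a + b = 1 →
    (a : EReal) * extLog f s + (b : EReal) * extLog f t ≤ extLog f (a • s + b • t)

/-- The log-concave probability densities on `ℝ^d`. -/
def logConcaveDensities (d : ℕ) : Set (Pt d → ℝ) :=
  {f | (∀ t, 0 ≤ f t) ∧ IsLogConcave f ∧ Integrable f ∧ ∫ t, f t = 1}

/-- The log-likelihood `∑ w_i log f(x_i)` of the sample `(X, w)`. -/
def logLikelihood {d n : ℕ} (x : Fin n → Pt d) (w : Fin n → ℝ) (f : Pt d → ℝ) : EReal :=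
  ∑ i, (w i : EReal) * extLog f (x i)

/-- The Samworth body `S(X)`. -/
def samworthBody {d n : ℕ} (x : Fin n → Pt d) : Set (Fin n → ℝ) :=
  {y | ∫ t in hull x, Real.exp (tent x y t) ≤ 1}

/-- The linear functional `y ↦ w · y`. -/
def linObj {n : ℕ} (w y : Fin n → ℝ) : ℝ := ∑ i, w i * y i

/-- The objective `y ↦ w · y - ∫_P exp(h_{X,y}(t)) dt` of the unconstrained problem. -/
def unconstrainedObj {d n : ℕ} (x : Fin n → Pt d) (w y : Fin n → ℝ) : ℝ :=
  linObj w y - ∫ t in hull x, Real.exp (tent x y t)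

/-- `y` is the optimal solution, for the weights `w`, of all three problems: maximum likelihood
over log-concave densities, maximization of `w · y` over the Samworth body, and the unconstrained
problem. -/
def IsTheOptimum {d n : ℕ} (x : Fin n → Pt d) (w y : Fin n → ℝ) : Prop :=
  IsUniqueMaximizer (logLikelihood x w) (logConcaveDensities d) (tentDensity x y) ∧
  IsUniqueMaximizer (linObj w) (samworthBody x) y ∧
  IsUniqueMaximizer (unconstrainedObj x w) univ y

end

end LogConcaveMLE

open LogConcaveMLE

namespace LogConcaveMLE

/-! ### Convex combinations and the tent function -/

/-! Fix a regular triangulation `Δ` that refines the subdivision induced by `y`. On each simplex of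
`Δ` the tent function `h` of `y` is affine, and relevance makes it the interpolation of the heights
`y` at the vertices. The function `H` is an integral in disguise: `H u` equals the integral of `(1 -
∑ s_i) exp (∑ s_i u_i)` over the corner simplex (`H_eq_integral`). Transported by an affine chart,
each summand of `w_k` becomes the integral over `σ` of the barycentric coordinate of `x_k` times
`exp h` (`weight_summand_eq_integral`).

Consequently `w · v = ∫ l_v exp h` for every vector `v`, where `l_v` is the piecewise affine
interpolation of `v` on `Δ`. Taking `v = 1` gives `∑ w_k = ∫ exp h = 1`. From `1 + s ≤ exp s`
follows `(l_v - h + 1) exp h ≤ exp l_v`, which integrates to `w · v ≤ w · y - ∫ exp h + ∫ F` for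
every integrable `F ≥ exp l_v` (`linObj_le`); equality forces `l_v = h` on every simplex, that is,
`v = y` at all vertices of `Δ` (`eq_of_linObj_eq`).

All three problems are instances of this bound. Problems (2) and (3) use `F = exp h_v`, as the
concave function `h_v` dominates `l_v`. Problem (1) uses `v_k = log f(x_k)` and `F = f`. In the
equality case `f` dominates the tent density and has the same mass, so the two agree almost
everywhere, and concavity upgrades this to everywhere (`eq_tentDensity`).

A triangulation using every point comes from heights `y + ε q`, with `q` a generic perturbation of
the strictly concave heights `-‖x_i‖²`. Genericity makes all cells simplices, relevance of `q` keeps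
every point in use, and small `ε` ensures refinement (`exists_regularTriangulation_refines`). -/

theorem mem_convexHull_range_iff {ι E : Type*} [Fintype ι] [AddCommGroup E] [Module ℝ E]
    (v : ι → E) (t : E) :
    t ∈ convexHull ℝ (range v) ↔
      ∃ a : ι → ℝ, (∀ i, 0 ≤ a i) ∧ ∑ i, a i = 1 ∧ ∑ i, a i • v i = t := by
  constructor
  · intro h
    rw [convexHull_range_eq_exists_affineCombination] at h
    obtain ⟨s, a, h0, h1, rfl⟩ := h
    classical
    refine ⟨fun i => if i ∈ s then a i else 0, fun i => ?_, ?_, ?_⟩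
    · dsimp only
      split_ifs with hi
      exacts [h0 i hi, le_rfl]
    · simpa using h1
    · rw [Finset.affineCombination_eq_linear_combination _ _ _ h1]
      simp [ite_smul]
  · rintro ⟨a, h0, h1, rfl⟩
    exact (convex_convexHull ℝ _).sum_mem (fun i _ => h0 i) h1
      fun i _ => subset_convexHull ℝ _ (mem_range_self i)

theorem sum_dite_mem_smul {ι F : Type*} [Fintype ι] [DecidableEq ι] [AddCommGroup F] [Module ℝ F]
    (C : Finset ι) (a : ↥(C : Set ι) → ℝ) (g : ι → F) :
    ∑ i, (if hi : i ∈ C then a ⟨i, hi⟩ else 0) • g i = ∑ i : (C : Set ι), a i • g i := by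
  rw [← Finset.sum_subset (Finset.subset_univ C), ← Finset.sum_coe_sort]
  · exact Finset.sum_congr rfl fun i _ => by simp
  · intro i _ hi
    simp [hi]

theorem mem_convexHull_image_iff {ι E : Type*} [Fintype ι] [AddCommGroup E] [Module ℝ E]
    (v : ι → E) (C : Finset ι) (t : E) :
    t ∈ convexHull ℝ (v '' (C : Set ι)) ↔
      ∃ a : ι → ℝ, (∀ i, 0 ≤ a i) ∧ (∀ i, i ∉ C → a i = 0) ∧ ∑ i, a i = 1 ∧
        ∑ i, a i • v i = t := by
  classical
  constructor
  · intro h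
    rw [image_eq_range] at h
    obtain ⟨a, h0, h1, rfl⟩ := (mem_convexHull_range_iff _ t).1 h
    refine ⟨fun i => if hi : i ∈ C then a ⟨i, hi⟩ else 0, fun i => ?_, fun i hi => ?_, ?_, ?_⟩
    · dsimp only
      split_ifs
      exacts [h0 _, le_rfl]
    · simp [hi]
    · rw [← h1]
      simpa using sum_dite_mem_smul C a (fun _ => (1 : ℝ))
    · exact sum_dite_mem_smul C a v
  · rintro ⟨a, h0, hC, h1, rfl⟩
    rw [← Finset.sum_subset (Finset.subset_univ C)] at h1 ⊢
    · exact (convex_convexHull ℝ _).sum_mem (fun i _ => h0 i) h1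
        fun i hi => subset_convexHull ℝ _ (mem_image_of_mem _ hi)
    · intro i _ hi
      simp [hC i hi]
    · intro i _ hi
      exact hC i hi

variable {d n : ℕ} (x : Fin n → Pt d) (y : Fin n → ℝ)

theorem bddAbove_tent_set (t : Pt d) :
    BddAbove {s : ℝ | (t, s) ∈ convexHull ℝ (range fun i => (x i, y i))} := by
  refine ⟨∑ i, |y i|, fun s hs => ?_⟩
  obtain ⟨a, h0, h1, h⟩ := (mem_convexHull_range_iff _ _).1 hs
  have h2 : s = ∑ i, a i * y i := by
    simpa [Prod.snd_sum] using (congrArg Prod.snd h).symm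
  rw [h2]
  refine Finset.sum_le_sum fun i _ => ?_
  have hi : a i ≤ 1 := h1 ▸ Finset.single_le_sum (fun j _ => h0 j) (Finset.mem_univ i)
  nlinarith [le_abs_self (y i), abs_nonneg (y i), h0 i,
    mul_le_mul_of_nonneg_left (le_abs_self (y i)) (h0 i)]

theorem sum_le_tent {a : Fin n → ℝ} (h0 : ∀ i, 0 ≤ a i) (h1 : ∑ i, a i = 1) {t : Pt d}
    (ht : ∑ i, a i • x i = t) : ∑ i, a i * y i ≤ tent x y t := by
  refine le_csSup (bddAbove_tent_set x y t) ?_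
  refine (mem_convexHull_range_iff _ _).2 ⟨a, h0, h1, ?_⟩
  ext1
  · simpa [Prod.fst_sum] using ht
  · simp [Prod.snd_sum]

theorem le_tent_self (i : Fin n) : y i ≤ tent x y (x i) := by
  classical
  simpa [Pi.single_apply] using sum_le_tent x y (a := Pi.single i 1)
    (fun j => by by_cases h : j = i <;> simp [h]) (by simp) (t := x i)
    (by simp [Pi.single_apply, ite_smul])

theorem exists_tent_eq {t : Pt d} (ht : t ∈ hull x) :
    ∃ a : Fin n → ℝ, (∀ i, 0 ≤ a i) ∧ ∑ i, a i = 1 ∧ ∑ i, a i • x i = t ∧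
      tent x y t = ∑ i, a i * y i := by
  have hcl : IsClosed {s : ℝ | (t, s) ∈ convexHull ℝ (range fun i => (x i, y i))} :=
    ((finite_range _).isClosed_convexHull (𝕜 := ℝ)).preimage (Continuous.prodMk_right t)
  have hne : {s : ℝ | (t, s) ∈ convexHull ℝ (range fun i => (x i, y i))}.Nonempty := by
    obtain ⟨a, h0, h1, h⟩ := (mem_convexHull_range_iff _ _).1 ht
    refine ⟨∑ i, a i * y i, (mem_convexHull_range_iff _ _).2 ⟨a, h0, h1, ?_⟩⟩
    ext1
    · simpa [Prod.fst_sum] using h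
    · simp [Prod.snd_sum]
  obtain ⟨a, h0, h1, h⟩ := (mem_convexHull_range_iff _ _).1
    (hcl.csSup_mem hne (bddAbove_tent_set x y t))
  refine ⟨a, h0, h1, ?_, ?_⟩
  · simpa [Prod.fst_sum] using congrArg Prod.fst h
  · rw [tent]
    simpa [Prod.snd_sum] using (congrArg Prod.snd h).symm

theorem affineMap_sum_smul {ι : Type*} [Fintype ι] (l : Pt d →ᵃ[ℝ] ℝ) (v : ι → Pt d)
    {a : ι → ℝ} (h1 : ∑ i, a i = 1) : l (∑ i, a i • v i) = ∑ i, a i * l (v i) := by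
  rw [← Finset.affineCombination_eq_linear_combination _ _ _ h1,
    Finset.map_affineCombination _ _ _ h1,
    Finset.affineCombination_eq_linear_combination _ _ _ h1]
  simp

theorem concaveOn_tent : ConcaveOn ℝ (hull x) (tent x y) := by
  refine ⟨convex_convexHull ℝ _, fun s hs t ht p q hp hq hpq => ?_⟩
  obtain ⟨a, a0, a1, as, ha⟩ := exists_tent_eq x y hs
  obtain ⟨b, b0, b1, bt, hb⟩ := exists_tent_eq x y ht
  have := sum_le_tent x y (a := fun i => p * a i + q * b i) (t := p • s + q • t)
    (fun i => add_nonneg (mul_nonneg hp (a0 i)) (mul_nonneg hq (b0 i)))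
    (by rw [Finset.sum_add_distrib, ← Finset.mul_sum, ← Finset.mul_sum, a1, b1]; simpa)
    (by simp only [add_smul, mul_smul, Finset.sum_add_distrib, ← Finset.smul_sum, as, bt])
  refine le_trans (le_of_eq ?_) this
  simp only [ha, hb, smul_eq_mul, add_mul, Finset.sum_add_distrib, Finset.mul_sum, mul_assoc]

theorem tent_le_of_forall_le {l : Pt d →ᵃ[ℝ] ℝ} (hl : ∀ i, y i ≤ l (x i)) {t : Pt d}
    (ht : t ∈ hull x) : tent x y t ≤ l t := by
  obtain ⟨a, a0, a1, rfl, ha⟩ := exists_tent_eq x y ht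
  rw [ha, affineMap_sum_smul l x a1]
  exact Finset.sum_le_sum fun i _ => mul_le_mul_of_nonneg_left (hl i) (a0 i)

theorem isClosed_hull : IsClosed (hull x) :=
  (finite_range x).isClosed_convexHull (𝕜 := ℝ)

theorem measurableSet_hull : MeasurableSet (hull x) := (isClosed_hull x).measurableSet

theorem isCompact_hull : IsCompact (hull x) := (finite_range x).isCompact_convexHull (𝕜 := ℝ)

theorem convexHull_image_subset_hull (C : Set (Fin n)) : convexHull ℝ (x '' C) ⊆ hull x :=
  convexHull_mono (image_subset_range x C)

theorem isCompact_convexHull_image (C : Set (Fin n)) : IsCompact (convexHull ℝ (x '' C)) :=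
  (C.toFinite.image x).isCompact_convexHull (𝕜 := ℝ)

theorem measurableSet_convexHull_image (C : Set (Fin n)) :
    MeasurableSet (convexHull ℝ (x '' C)) :=
  (isCompact_convexHull_image x C).isClosed.measurableSet

/-- Concavity gives continuity only in the interior, which suffices for measurability because the
frontier of a convex set is null. The constant `∑ |y_i|` bounds the tent from above. -/
theorem integrableOn_exp_tent : IntegrableOn (fun t => Real.exp (tent x y t)) (hull x) := by
  have hconv : Convex ℝ (hull x) := convex_convexHull ℝ _
  have hae : interior (hull x) =ᵐ[volume] hull x :=
    interior_ae_eq_of_null_frontier (hconv.addHaar_frontier volume)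
  have hm : AEStronglyMeasurable (fun t => Real.exp (tent x y t))
      (volume.restrict (hull x)) := by
    rw [← Measure.restrict_congr_set hae]
    exact ((concaveOn_tent x y).continuousOn_interior.rexp).aestronglyMeasurable
      isOpen_interior.measurableSet
  have : IsFiniteMeasure (volume.restrict (hull x)) :=
    ⟨by simpa using (isCompact_hull x).measure_lt_top⟩
  refine Integrable.of_bound hm (Real.exp (∑ i, |y i|)) ?_
  filter_upwards [ae_restrict_mem (measurableSet_hull x)] with t ht
  rw [Real.norm_eq_abs, abs_of_pos (Real.exp_pos _)]
  refine Real.exp_le_exp.2 ?_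
  refine tent_le_of_forall_le x y (l := AffineMap.const ℝ _ (∑ i, |y i|)) (fun i => ?_) ht
  exact (le_abs_self _).trans
    (Finset.single_le_sum (fun j _ => abs_nonneg (y j)) (Finset.mem_univ i))

end LogConcaveMLE

namespace LogConcaveMLE

/-! ### Affine interpolation -/

/-- The affine function with prescribed values on an affine basis. -/
noncomputable def interp {ι : Type*} [Fintype ι] {d : ℕ} (b : AffineBasis ι ℝ (Pt d))
    (c : ι → ℝ) : Pt d →ᵃ[ℝ] ℝ where
  toFun t := ∑ i, b.coord i t * c i
  linear := ∑ i, c i • (b.coord i).linear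
  map_vadd' t v := by
    simp only [LinearMap.sum_apply, LinearMap.smul_apply, smul_eq_mul, vadd_eq_add,
      ← Finset.sum_add_distrib]
    refine Finset.sum_congr rfl fun i _ => ?_
    rw [← vadd_eq_add, AffineMap.map_vadd, vadd_eq_add]
    ring

theorem interp_apply {ι : Type*} [Fintype ι] {d : ℕ} (b : AffineBasis ι ℝ (Pt d))
    (c : ι → ℝ) (t : Pt d) : interp b c t = ∑ i, b.coord i t * c i := rfl

theorem interp_basis {ι : Type*} [Fintype ι] {d : ℕ} (b : AffineBasis ι ℝ (Pt d))
    (c : ι → ℝ) (i : ι) : interp b c (b i) = c i := by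
  classical
  simp [interp_apply, AffineBasis.coord_apply]

theorem eq_interp {ι : Type*} [Fintype ι] {d : ℕ} (b : AffineBasis ι ℝ (Pt d))
    (l : Pt d →ᵃ[ℝ] ℝ) : l = interp b fun i => l (b i) := by
  ext t
  conv_lhs => rw [← b.linear_combination_coord_eq_self t]
  rw [affineMap_sum_smul l b (b.sum_coord_apply_eq_one t), interp_apply]

theorem continuous_affineMap {d : ℕ} (l : Pt d →ᵃ[ℝ] ℝ) : Continuous l :=
  l.continuous_of_finiteDimensional

variable {d n : ℕ} (x : Fin n → Pt d) (z : Fin n → ℝ)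

/-! ### Cells of regular subdivisions -/

/-- The graph of `l` is a supporting hyperplane of the lifted points. A convex combination of lifted
points reaches it only if all its weight sits on points that lie on it, namely those of `C`. -/
theorem isCell_of_forall_le {l : Pt d →ᵃ[ℝ] ℝ} (hl : ∀ i, z i ≤ l (x i)) {C : Finset (Fin n)}
    (hC : ∀ i, i ∈ C ↔ z i = l (x i))
    (hspan : affineSpan ℝ (x '' (C : Set (Fin n))) = ⊤) : IsCell x z C := by
  have hloc : convexHull ℝ (x '' (C : Set (Fin n))) = {t | t ∈ hull x ∧ tent x z t = l t} := by
    ext t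
    rw [mem_convexHull_image_iff]
    constructor
    · rintro ⟨a, a0, aC, a1, rfl⟩
      have ht : ∑ i, a i • x i ∈ hull x := (mem_convexHull_range_iff _ _).2 ⟨a, a0, a1, rfl⟩
      refine ⟨ht, le_antisymm (tent_le_of_forall_le x z hl ht) ?_⟩
      refine le_trans (le_of_eq ?_) (sum_le_tent x z a0 a1 rfl)
      rw [affineMap_sum_smul l x a1]
      refine Finset.sum_congr rfl fun i _ => ?_
      by_cases hi : i ∈ C
      · rw [(hC i).1 hi]
      · simp [aC i hi]
    · rintro ⟨ht, hlt⟩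
      obtain ⟨a, a0, a1, rfl, ha⟩ := exists_tent_eq x z ht
      refine ⟨a, a0, fun i hi => ?_, a1, rfl⟩
      rw [ha, affineMap_sum_smul l x a1,
        Finset.sum_eq_sum_iff_of_le fun i _ => mul_le_mul_of_nonneg_left (hl i) (a0 i)] at hlt
      by_contra hne
      exact hi ((hC i).2 (mul_left_cancel₀ hne (hlt i (Finset.mem_univ i))))
  refine ⟨interior_convexHull_nonempty_iff_affineSpan_eq_top.2 hspan, ⟨l, hloc⟩, fun i => ?_⟩
  constructor
  · intro hi
    have hmem : x i ∈ convexHull ℝ (x '' (C : Set (Fin n))) :=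
      subset_convexHull ℝ _ (mem_image_of_mem x hi)
    refine ⟨hmem, ?_⟩
    rw [hloc] at hmem
    rw [hmem.2, (hC i).1 hi]
  · rintro ⟨hmem, hi⟩
    rw [hloc] at hmem
    rw [hC, ← hi, hmem.2]

theorem exists_cell_of_forall_le {l : Pt d →ᵃ[ℝ] ℝ} (hl : ∀ i, z i ≤ l (x i)) {S : Set (Fin n)}
    (hS : ∀ i ∈ S, z i = l (x i)) (hspan : affineSpan ℝ (x '' S) = ⊤) :
    ∃ C : Finset (Fin n), IsCell x z C ∧ ∀ i ∈ S, i ∈ C := by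
  classical
  refine ⟨Finset.univ.filter fun i => z i = l (x i),
    isCell_of_forall_le x z hl (by simp) ?_, fun i hi => by simpa using hS i hi⟩
  rw [eq_top_iff, ← hspan]
  refine affineSpan_mono ℝ (image_mono fun i hi => ?_)
  simpa using hS i hi

/-- First-order optimality of a convex combination that attains the tent function. -/
theorem sum_mul_nonpos_of_optimal {a : Fin n → ℝ} (a0 : ∀ i, 0 ≤ a i) (a1 : ∑ i, a i = 1)
    (hopt : tent x z (∑ i, a i • x i) = ∑ i, a i * z i) {ν : Fin n → ℝ} (ν0 : ∑ i, ν i = 0)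
    (νx : ∑ i, ν i • x i = 0) (hν : ∀ i, a i = 0 → 0 ≤ ν i) : ∑ i, ν i * z i ≤ 0 := by
  -- For small `ε > 0` the vector `a + ε ν` is still a system of convex coefficients for the same
  -- point, so it cannot beat the optimum.
  have hev : ∀ᶠ ε : ℝ in nhdsWithin 0 (Ioi 0), ∀ i, 0 ≤ a i + ε * ν i := by
    refine Filter.eventually_all.2 fun i => ?_
    rcases (a0 i).eq_or_lt with h | h
    · filter_upwards [self_mem_nhdsWithin] with ε hε
      rw [← h, zero_add]
      exact mul_nonneg (le_of_lt hε) (hν i h.symm)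
    · have hc : Filter.Tendsto (fun ε : ℝ => a i + ε * ν i) (nhdsWithin 0 (Ioi 0))
          (nhds (a i + 0 * ν i)) :=
        ((continuous_const.add (continuous_id.mul continuous_const)).tendsto 0).mono_left
          nhdsWithin_le_nhds
      rw [zero_mul, add_zero] at hc
      exact (hc.eventually (lt_mem_nhds h)).mono fun _ h => h.le
  obtain ⟨ε, hε, hε0⟩ := (hev.and self_mem_nhdsWithin).exists
  have := sum_le_tent x z (a := fun i => a i + ε * ν i) hε
    (by rw [Finset.sum_add_distrib, ← Finset.mul_sum, a1, ν0]; simp)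
    (t := ∑ i, a i • x i)
    (by simp only [add_smul, mul_smul, Finset.sum_add_distrib, ← Finset.smul_sum, νx]; simp)
  rw [hopt] at this
  simp only [add_mul, mul_assoc, Finset.sum_add_distrib, ← Finset.mul_sum] at this
  by_contra hpos
  nlinarith [mul_pos (show 0 < ε from hε0) (not_le.1 hpos)]

/-- This is linear programming duality with complementary slackness: interpolating `z` on an affine
basis chosen from the support of `a` yields the dual solution, an affine majorant that is tight on
the whole support. -/
theorem exists_cell_of_optimal {a : Fin n → ℝ} (a0 : ∀ i, 0 ≤ a i) (a1 : ∑ i, a i = 1)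
    (hopt : tent x z (∑ i, a i • x i) = ∑ i, a i * z i)
    (hspan : affineSpan ℝ (x '' {i | 0 < a i}) = ⊤) :
    ∃ C : Finset (Fin n), IsCell x z C ∧ ∀ i, 0 < a i → i ∈ C := by
  classical
  obtain ⟨s, hs, b, hb⟩ := AffineBasis.exists_affine_subbasis hspan
  have : Fintype s := (((toFinite _).image x).subset hs).fintype
  have hj : ∀ p : s, ∃ j, 0 < a j ∧ x j = b p := fun p => by
    obtain ⟨j, hj, hjp⟩ := hs p.2
    exact ⟨j, hj, by rw [hjp, hb]⟩
  choose j hja hjx using hj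
  set l := interp b fun p => z (j p) with hl
  have key : ∀ i, z i - l (x i) ≤ 0 ∧ (0 < a i → l (x i) - z i ≤ 0) := by
    intro i
    -- The test direction is `e_i` minus the barycentric expression of `x i` in the chosen basis. It
    -- is an affine dependence, negative only inside the support of `a`; if `a i > 0`, its negative
    -- is admissible too.
    set ν : Fin n → ℝ := fun m =>
      (if m = i then 1 else 0) - ∑ p, if m = j p then b.coord p (x i) else 0 with hν
    have hsum : ∀ {F : Type} [AddCommGroup F] [Module ℝ F] (g : Fin n → F),
        ∑ m, ν m • g m = g i - ∑ p, b.coord p (x i) • g (j p) := by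
      intro F _ _ g
      simp only [hν, sub_smul, Finset.sum_sub_distrib, Finset.sum_smul, ite_smul, one_smul,
        zero_smul, Finset.sum_ite_eq', Finset.mem_univ, if_true]
      rw [Finset.sum_comm]
      simp
    have ν0 : ∑ m, ν m = 0 := by
      have := hsum fun _ => (1 : ℝ)
      simpa [b.sum_coord_apply_eq_one] using this
    have νx : ∑ m, ν m • x m = 0 := by
      rw [hsum]
      simp only [hjx]
      rw [b.linear_combination_coord_eq_self, sub_self]
    have νz : ∑ m, ν m * z m = z i - l (x i) := by
      simpa [hl, interp_apply] using hsum z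
    have hνa : ∀ m, a m = 0 → ν m = if m = i then 1 else 0 := by
      intro m hm
      have : ∀ p, m ≠ j p := fun p hp => (hja p).ne' (hp ▸ hm)
      simp [hν, this]
    refine ⟨?_, fun hi => ?_⟩
    · rw [← νz]
      refine sum_mul_nonpos_of_optimal x z a0 a1 hopt ν0 νx fun m hm => ?_
      rw [hνa m hm]
      split_ifs <;> norm_num
    · have := sum_mul_nonpos_of_optimal x z a0 a1 hopt (ν := fun m => -ν m)
        (by rw [Finset.sum_neg_distrib, ν0, neg_zero])
        (by simp only [neg_smul, Finset.sum_neg_distrib, νx, neg_zero]) fun m hm => by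
          have hmi : m ≠ i := fun h => hi.ne' (h ▸ hm)
          rw [hνa m hm, if_neg hmi, neg_zero]
      simp only [neg_mul, Finset.sum_neg_distrib, νz] at this
      linarith
  exact exists_cell_of_forall_le x z (l := l) (fun i => sub_nonpos.1 (key i).1)
    (fun i hi => le_antisymm (sub_nonpos.1 (key i).1) (sub_nonpos.1 ((key i).2 hi))) hspan

theorem mem_regularSubdivision {C : Finset (Fin n)} :
    C ∈ regularSubdivision x z ↔ IsCell x z C := by
  simp [regularSubdivision]

theorem volume_convexHull_eq_zero {s : Set (Pt d)} (hs : affineSpan ℝ s ≠ ⊤) :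
    volume (convexHull ℝ s) = 0 :=
  measure_mono_null (convexHull_subset_affineSpan s) (Measure.addHaar_affineSubspace volume _ hs)

theorem interior_hull_nonempty {x : Fin n → Pt d} (hdim : affineSpan ℝ (range x) = ⊤) :
    (interior (hull x)).Nonempty :=
  interior_convexHull_nonempty_iff_affineSpan_eq_top.2 hdim

/-- The cells of a regular subdivision cover the polytope. -/
theorem exists_cell_mem {x : Fin n → Pt d} (hdim : affineSpan ℝ (range x) = ⊤) {t : Pt d}
    (ht : t ∈ hull x) :
    ∃ C ∈ regularSubdivision x z, t ∈ convexHull ℝ (x '' (C : Set (Fin n))) := by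
  by_contra hcon
  push Not at hcon
  -- The union of the cells is closed, so missing one point of the polytope means missing a nonempty
  -- open subset of it, which has positive measure.
  set K := ⋃ C ∈ regularSubdivision x z, convexHull ℝ (x '' (C : Set (Fin n))) with hK
  have hKcl : IsClosed K :=
    (Finset.finite_toSet _).isClosed_biUnion fun C _ => (isCompact_convexHull_image x _).isClosed
  have htK : t ∈ Kᶜ := by simpa [hK] using hcon
  have htcl : t ∈ closure (interior (hull x)) := by
    rw [(concaveOn_tent x z).1.closure_interior_eq_closure_of_nonempty_interior
      (interior_hull_nonempty hdim)]
    exact subset_closure ht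
  have hne : (Kᶜ ∩ interior (hull x)).Nonempty :=
    mem_closure_iff.1 htcl _ hKcl.isOpen_compl htK
  have hpos : 0 < volume (Kᶜ ∩ interior (hull x)) :=
    (hKcl.isOpen_compl.inter isOpen_interior).measure_pos volume hne
  -- Points outside this null set have no convex representation with degenerate support, so
  -- `exists_cell_of_optimal` applies to them.
  set N := ⋃ S ∈ {S : Set (Fin n) | affineSpan ℝ (x '' S) ≠ ⊤}, convexHull ℝ (x '' S) with hN
  have hN0 : volume N = 0 :=
    (measure_biUnion_null_iff (to_countable _)).2 fun S hS => volume_convexHull_eq_zero hS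
  obtain ⟨u, ⟨huK, huP⟩, huN⟩ : ((Kᶜ ∩ interior (hull x)) \ N).Nonempty := by
    rw [nonempty_iff_ne_empty, Ne, sdiff_eq_empty]
    exact fun h => hpos.ne' (measure_mono_null h hN0)
  obtain ⟨a, a0, a1, rfl, ha⟩ := exists_tent_eq x z (interior_subset huP)
  have hmem : ∀ C : Finset (Fin n), (∀ i, 0 < a i → i ∈ C) →
      ∑ i, a i • x i ∈ convexHull ℝ (x '' (C : Set (Fin n))) := fun C hC =>
    (mem_convexHull_image_iff x C _).2 ⟨a, a0, fun i hi =>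
      ((a0 i).eq_or_lt.resolve_right fun h => hi (hC i h)).symm, a1, rfl⟩
  have hspan : affineSpan ℝ (x '' {i | 0 < a i}) = ⊤ := by
    by_contra hsp
    refine huN (mem_biUnion (x := {i | 0 < a i}) hsp ?_)
    simpa using hmem (toFinite {i | 0 < a i}).toFinset (by simp)
  obtain ⟨C, hC, haC⟩ := exists_cell_of_optimal x z a0 a1 ha hspan
  exact huK (mem_biUnion (x := C) ((mem_regularSubdivision x z).2 hC) (hmem C haC))

theorem iUnion_cells {x : Fin n → Pt d} (hdim : affineSpan ℝ (range x) = ⊤) :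
    ⋃ C : regularSubdivision x z, convexHull ℝ (x '' ((C : Finset (Fin n)) : Set (Fin n)))
      = hull x := by
  refine subset_antisymm (iUnion_subset fun C => convexHull_image_subset_hull x _) fun t ht => ?_
  obtain ⟨C, hC, h⟩ := exists_cell_mem z hdim ht
  exact mem_iUnion.2 ⟨⟨C, hC⟩, h⟩

theorem volume_setOf_eq_eq_zero {l l' : Pt d →ᵃ[ℝ] ℝ} (h : l ≠ l') :
    volume {t | l t = l' t} = 0 := by
  rcases isEmpty_or_nonempty {t // l t = l' t} with hemp | ⟨⟨t₀, h₀⟩⟩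
  · have : {t | l t = l' t} = ∅ := by
      ext t
      simpa using fun ht => hemp.false ⟨t, ht⟩
    simp [this]
  · have hset : {t | l t = l' t} =
        ((AffineSubspace.mk' t₀ (LinearMap.ker (l.linear - l'.linear)) :
          AffineSubspace ℝ (Pt d)) : Set (Pt d)) := by
      ext t
      rw [SetLike.mem_coe, AffineSubspace.mem_mk', LinearMap.mem_ker, LinearMap.sub_apply,
        AffineMap.linearMap_vsub, AffineMap.linearMap_vsub]
      simp [h₀, sub_eq_zero]
    rw [hset]
    refine Measure.addHaar_affineSubspace volume _ fun htop => h ?_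
    ext t
    have : t ∈ {t | l t = l' t} := by rw [hset, htop]; trivial
    exact this

/-- A cell is determined by its affine function. Distinct cells thus have distinct affine functions,
and they overlap only where these agree, inside a proper affine subspace. -/
theorem aedisjoint_cells {C C' : Finset (Fin n)} (hC : IsCell x z C) (hC' : IsCell x z C')
    (hne : C ≠ C') : AEDisjoint volume (convexHull ℝ (x '' (C : Set (Fin n))))
      (convexHull ℝ (x '' (C' : Set (Fin n)))) := by
  obtain ⟨-, ⟨l, hl⟩, hi⟩ := hC
  obtain ⟨-, ⟨l', hl'⟩, hi'⟩ := hC'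
  have hll : l ≠ l' := by
    rintro rfl
    refine hne (Finset.ext fun i => ?_)
    rw [hi, hi', hl, hl']
  refine measure_mono_null ?_ (volume_setOf_eq_eq_zero hll)
  rw [hl, hl']
  exact fun t ht => ht.1.2.symm.trans ht.2.2

/-- On a cell, the tent function is the restriction of an affine function that is nowhere smaller. -/
theorem IsCell.exists_affine {C : Finset (Fin n)} (hC : IsCell x z C) :
    ∃ l : Pt d →ᵃ[ℝ] ℝ, (∀ t ∈ convexHull ℝ (x '' (C : Set (Fin n))), tent x z t = l t) ∧
      (∀ i ∈ C, z i = l (x i)) ∧ ∀ i, z i ≤ l (x i) := by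
  obtain ⟨⟨u, hu⟩, ⟨l, hl⟩, hi⟩ := hC
  have hloc : ∀ t ∈ convexHull ℝ (x '' (C : Set (Fin n))), tent x z t = l t := fun t ht => by
    rw [hl] at ht
    exact ht.2
  refine ⟨l, hloc, fun i hiC => ?_, fun i => (le_tent_self x z i).trans ?_⟩
  · rw [← hloc _ ((hi i).1 hiC).1, ((hi i).1 hiC).2]
  -- An interior point `u` of the cell lies between `x i` and a point slightly beyond `u` that is
  -- still in the cell. Concavity of the tent along this segment gives the bound at `x i`.
  · have hc : Filter.Tendsto (fun ε : ℝ => u + ε • (u - x i)) (nhdsWithin 0 (Ioi 0))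
        (nhds (u + (0 : ℝ) • (u - x i))) :=
      ((continuous_const.add (continuous_id.smul continuous_const)).tendsto 0).mono_left
        nhdsWithin_le_nhds
    rw [zero_smul, add_zero] at hc
    obtain ⟨ε, hε, hε0⟩ :=
      ((hc.eventually (isOpen_interior.mem_nhds hu)).and self_mem_nhdsWithin).exists
    replace hε0 : 0 < ε := hε0
    have hp := interior_subset hε
    have h1 : (0 : ℝ) < 1 + ε := by linarith
    have hcomb : (1 + ε)⁻¹ • (u + ε • (u - x i)) + (ε * (1 + ε)⁻¹) • x i = u := by
      have : u + ε • (u - x i) = (1 + ε) • u - ε • x i := by module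
      rw [this, smul_sub, smul_smul, smul_smul, inv_mul_cancel₀ h1.ne', mul_comm ε, one_smul,
        sub_add_cancel]
    have hsum : (1 + ε)⁻¹ + ε * (1 + ε)⁻¹ = 1 := by field_simp
    have hconc := (concaveOn_tent x z).2 (convexHull_image_subset_hull x _ hp)
      (subset_convexHull ℝ _ (mem_range_self i)) (inv_pos.2 h1).le
      (mul_pos hε0 (inv_pos.2 h1)).le hsum
    have haff : l u = (1 + ε)⁻¹ * l (u + ε • (u - x i)) + (ε * (1 + ε)⁻¹) * l (x i) := by
      conv_lhs => rw [← hcomb]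
      exact Convex.combo_affine_apply hsum
    rw [hcomb, hloc _ hp, hloc _ (interior_subset hu), haff] at hconc
    simp only [smul_eq_mul] at hconc
    exact le_of_mul_le_mul_left (by linarith) (mul_pos hε0 (inv_pos.2 h1))

end LogConcaveMLE

namespace LogConcaveMLE

variable {d n : ℕ} (x : Fin n → Pt d)

/-! ### Relevant vectors and existence of fine regular triangulations -/

/-- In this form relevance is a system of homogeneous linear inequalities in `z`, so relevant
vectors form a convex cone. -/
theorem isRelevant_iff {z : Fin n → ℝ} : IsRelevant x z ↔
    ∀ (k : Fin n) (a : Fin n → ℝ), (∀ i, 0 ≤ a i) → ∑ i, a i = 1 → ∑ i, a i • x i = x k →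
      ∑ i, a i * z i ≤ z k := by
  constructor
  · intro h k a a0 a1 ax
    rw [← h k]
    exact sum_le_tent x z a0 a1 ax
  · intro h k
    refine le_antisymm ?_ (le_tent_self x z k)
    obtain ⟨a, a0, a1, ax, ha⟩ :=
      exists_tent_eq x z (subset_convexHull ℝ _ (mem_range_self k))
    rw [ha]
    exact h k a a0 a1 ax

theorem IsRelevant.add_mul {x : Fin n → Pt d} {y q : Fin n → ℝ} (hy : IsRelevant x y)
    (hq : IsRelevant x q) {ε : ℝ} (hε : 0 ≤ ε) : IsRelevant x fun i => y i + ε * q i := by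
  rw [isRelevant_iff] at *
  intro k a a0 a1 ax
  have h1 := hy k a a0 a1 ax
  have h2 := mul_le_mul_of_nonneg_left (hq k a a0 a1 ax) hε
  have : ∑ i, a i * (y i + ε * q i) = ∑ i, a i * y i + ε * ∑ i, a i * q i := by
    rw [Finset.mul_sum, ← Finset.sum_add_distrib]
    exact Finset.sum_congr rfl fun i _ => by ring
  rw [this]
  exact add_le_add h1 h2

theorem eventually_add_mul_ne_zero (α : ℝ) {β : ℝ} (hβ : β ≠ 0) :
    ∀ᶠ ε in nhdsWithin (0 : ℝ) (Ioi 0), α + ε * β ≠ 0 := by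
  rcases eq_or_ne α 0 with rfl | hα
  · filter_upwards [self_mem_nhdsWithin] with ε hε
    simpa [hβ] using (ne_of_gt hε : ε ≠ 0)
  · have hc : Filter.Tendsto (fun ε : ℝ => α + ε * β) (nhdsWithin 0 (Ioi 0))
        (nhds (α + 0 * β)) :=
      ((continuous_const.add (continuous_id.mul continuous_const)).tendsto 0).mono_left
        nhdsWithin_le_nhds
    exact hc.eventually_ne (by simpa using hα)

theorem eventually_add_mul_lt_zero {α : ℝ} (hα : α < 0) (β : ℝ) :
    ∀ᶠ ε in nhdsWithin (0 : ℝ) (Ioi 0), α + ε * β < 0 := by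
  have hc : Filter.Tendsto (fun ε : ℝ => α + ε * β) (nhdsWithin 0 (Ioi 0))
      (nhds (α + 0 * β)) :=
    ((continuous_const.add (continuous_id.mul continuous_const)).tendsto 0).mono_left
      nhdsWithin_le_nhds
  exact hc.eventually_lt_const (by simpa using hα)

/-- Small perturbations of the strictly concave weights `-‖x_i‖²` are relevant. -/
theorem eventually_isRelevant_neg_norm_sq_add {x : Fin n → Pt d} (hx : Function.Injective x)
    (v : Fin n → ℝ) :
    ∀ᶠ δ in nhdsWithin (0 : ℝ) (Ioi 0), IsRelevant x fun i => -‖x i‖ ^ 2 + δ * v i := by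
  have hev : ∀ᶠ δ in nhdsWithin (0 : ℝ) (Ioi 0), ∀ i k, i ≠ k →
      -‖x i - x k‖ ^ 2 + δ * (v i - v k) < 0 := by
    refine Filter.eventually_all.2 fun i => Filter.eventually_all.2 fun k => ?_
    by_cases h : i = k
    · simp [h]
    · refine (eventually_add_mul_lt_zero ?_ _).mono fun _ hδ _ => hδ
      have : 0 < ‖x i - x k‖ := norm_pos_iff.2 (sub_ne_zero.2 (hx.ne h))
      nlinarith
  filter_upwards [hev] with δ hδ
  rw [isRelevant_iff]
  intro k a a0 a1 ax
  -- Since `x k` is the barycenter, the cross terms in the expansion of `‖x i‖²` around `x k`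
  -- cancel.
  have hinner : ∑ i, a i * inner ℝ (x i - x k) (x k) = 0 := by
    simp only [← real_inner_smul_left, ← sum_inner, smul_sub, Finset.sum_sub_distrib, ax,
      ← Finset.sum_smul, a1, one_smul, sub_self, inner_zero_left]
  have hsum : ∑ i, a i * (-‖x i‖ ^ 2 + δ * v i) - (-‖x k‖ ^ 2 + δ * v k)
      = ∑ i, a i * (-‖x i - x k‖ ^ 2 + δ * (v i - v k))
        - 2 * ∑ i, a i * inner ℝ (x i - x k) (x k) := by
    have h1 : -‖x k‖ ^ 2 + δ * v k = ∑ i, a i * (-‖x k‖ ^ 2 + δ * v k) := by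
      rw [← Finset.sum_mul, a1, one_mul]
    rw [h1, Finset.mul_sum, ← Finset.sum_sub_distrib, ← Finset.sum_sub_distrib]
    refine Finset.sum_congr rfl fun i _ => ?_
    have h2 := norm_add_sq_real (x i - x k) (x k)
    rw [sub_add_cancel] at h2
    rw [h2]
    ring
  have hle : ∑ i, a i * (-‖x i - x k‖ ^ 2 + δ * (v i - v k)) ≤ 0 := by
    refine Finset.sum_nonpos fun i _ => mul_nonpos_of_nonneg_of_nonpos (a0 i) ?_
    by_cases h : i = k
    · simp [h]
    · exact (hδ i k h).le
  rw [hinner] at hsum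
  linarith

/-- `μ` is an affine dependence among the points `x i`, `i ∈ C`. -/
def IsAffineDependence (C : Finset (Fin n)) (μ : Fin n → ℝ) : Prop :=
  (∀ i, i ∉ C → μ i = 0) ∧ ∑ i, μ i = 0 ∧ ∑ i, μ i • x i = 0

theorem exists_isAffineDependence {C : Finset (Fin n)}
    (hC : ¬ AffineIndependent ℝ fun i : {i // i ∈ C} => x i) :
    ∃ μ : Fin n → ℝ, IsAffineDependence x C μ ∧ μ ≠ 0 := by
  classical
  rw [affineIndependent_iff] at hC
  push Not at hC
  obtain ⟨s, w, w0, wx, e, he, hwe⟩ := hC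
  refine ⟨fun i => if hi : i ∈ C then (if ⟨i, hi⟩ ∈ s then w ⟨i, hi⟩ else 0) else 0,
    ⟨fun i hi => by simp [hi], ?_, ?_⟩, fun h => hwe ?_⟩
  · have := sum_dite_mem_smul C (fun i => if i ∈ s then w i else 0) (fun _ => (1 : ℝ))
    simp only [smul_eq_mul, mul_one] at this
    refine this.trans (Eq.trans ?_ w0)
    exact (Finset.sum_ite_mem _ _ _).trans (Finset.sum_congr (by ext; simp) fun _ _ => rfl)
  · refine (sum_dite_mem_smul C (fun i => if i ∈ s then w i else 0) x).trans ?_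
    rw [← wx]
    simp only [ite_smul, zero_smul]
    exact (Finset.sum_ite_mem _ _ _).trans (Finset.sum_congr (by ext; simp) fun _ _ => rfl)
  · have := congrFun h e
    simpa [e.2, he] using this

/-- A dependent cell forces a nontrivial linear equation on the heights. Generic heights violate all
of these finitely many equations, so their cells are simplices. -/
theorem IsAffineDependence.sum_mul_eq_zero {x : Fin n → Pt d} {C : Finset (Fin n)}
    {μ : Fin n → ℝ} (hμ : IsAffineDependence x C μ) {z : Fin n → ℝ} {l : Pt d →ᵃ[ℝ] ℝ}
    (hl : ∀ i ∈ C, z i = l (x i)) : ∑ i, μ i * z i = 0 := by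
  have h : ∀ i, μ i * z i = l.linear (μ i • x i) + μ i * l 0 := fun i => by
    by_cases hi : i ∈ C
    · have h0 : l (x i) = l.linear (x i) + l 0 := congrFun (AffineMap.decomp l) (x i)
      rw [hl i hi, h0, map_smul, smul_eq_mul]
      ring
    · simp [hμ.1 i hi]
  rw [Finset.sum_congr rfl fun i _ => h i, Finset.sum_add_distrib, ← map_sum, hμ.2.2,
    ← Finset.sum_mul, hμ.2.1]
  simp

/-- The vertices of a full-dimensional simplex as an affine basis. -/
def simplexBasis {x : Fin n → Pt d} {σ : Finset (Fin n)}
    (hind : AffineIndependent ℝ fun i : {i // i ∈ σ} => x i)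
    (hspan : affineSpan ℝ (x '' (σ : Set (Fin n))) = ⊤) :
    AffineBasis {i // i ∈ σ} ℝ (Pt d) where
  toFun i := x i
  ind' := hind
  tot' := by
    rw [← hspan, image_eq_range]
    rfl

theorem simplexBasis_apply {x : Fin n → Pt d} {σ : Finset (Fin n)}
    (hind : AffineIndependent ℝ fun i : {i // i ∈ σ} => x i)
    (hspan : affineSpan ℝ (x '' (σ : Set (Fin n))) = ⊤) (i : {i // i ∈ σ}) :
    simplexBasis hind hspan i = x i := rfl

theorem IsCell.affineSpan_eq_top {x : Fin n → Pt d} {z : Fin n → ℝ} {C : Finset (Fin n)}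
    (hC : IsCell x z C) : affineSpan ℝ (x '' (C : Set (Fin n))) = ⊤ :=
  interior_convexHull_nonempty_iff_affineSpan_eq_top.1 hC.1

/-- The affine function of `σ` for `y + ε q` is `ly + ε lq`. Were `ly` below `y` at some point, this
function would fail to be a majorant for small `ε`. So `ly` majorizes `y`, with equality on `σ`. -/
theorem eventually_exists_cell_superset (y q : Fin n → ℝ) (σ : Finset (Fin n))
    (hind : AffineIndependent ℝ fun i : {i // i ∈ σ} => x i) :
    ∀ᶠ ε in nhdsWithin (0 : ℝ) (Ioi 0), IsCell x (fun i => y i + ε * q i) σ →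
      ∃ C ∈ regularSubdivision x y, σ ⊆ C := by
  by_cases hspan : affineSpan ℝ (x '' (σ : Set (Fin n))) = ⊤
  swap
  · exact Filter.Eventually.of_forall fun ε h => absurd h.affineSpan_eq_top hspan
  set b := simplexBasis hind hspan
  set ly := interp b fun i => y i
  set lq := interp b fun i => q i
  have hev : ∀ᶠ ε in nhdsWithin (0 : ℝ) (Ioi 0), ∀ i, ly (x i) < y i →
      ly (x i) - y i + ε * (lq (x i) - q i) < 0 := by
    refine Filter.eventually_all.2 fun i => ?_
    by_cases h : ly (x i) < y i
    · exact (eventually_add_mul_lt_zero (sub_neg.2 h) _).mono fun _ h _ => h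
    · simp [h]
  filter_upwards [hev] with ε hε hcell
  obtain ⟨l, -, hlσ, hl⟩ := hcell.exists_affine
  have hlε : ∀ t, l t = ly t + ε * lq t := fun t => by
    rw [eq_interp b l]
    simp only [ly, lq, interp_apply, Finset.mul_sum, ← Finset.sum_add_distrib]
    refine Finset.sum_congr rfl fun i _ => ?_
    rw [simplexBasis_apply, ← hlσ i i.2]
    ring
  obtain ⟨C, hC, hσC⟩ := exists_cell_of_forall_le x y (l := ly) (S := σ)
    (fun i => by
      by_contra hlt
      have h1 := hε i (not_le.1 hlt)
      have h2 := hl i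
      rw [hlε] at h2
      linarith)
    (fun i hi => (interp_basis b (fun i => y i) ⟨i, hi⟩).symm) hspan
  exact ⟨C, (mem_regularSubdivision x y).2 hC, fun i hi => hσC i hi⟩

theorem exists_regularTriangulation_refines {x : Fin n → Pt d} (hx : Function.Injective x)
    (hdim : affineSpan ℝ (range x) = ⊤) {y : Fin n → ℝ} (hy : IsRelevant x y) :
    ∃ Δ : Finset (Finset (Fin n)), IsRegularTriangulation x Δ ∧
      Refines Δ (regularSubdivision x y) ∧ ∀ k, ∃ σ ∈ Δ, k ∈ σ := by
  classical
  choose μ hμ hμ0 using fun C : {C : Finset (Fin n) //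
    ¬ AffineIndependent ℝ fun i : {i // i ∈ C} => x i} => exists_isAffineDependence x C.2
  -- One nonzero dependence per dependent index set is enough. A linear functional nonzero on all of
  -- them exists, and its coordinate vector `v` serves as generic heights.
  obtain ⟨f, hf⟩ := Module.exists_dual_forall_apply_ne_zero (K := ℝ) μ hμ0
  set v : Fin n → ℝ := fun i => f (Pi.single i 1)
  have hv : ∀ C, ∑ i, μ C i * v i ≠ 0 := fun C => by
    have : f (μ C) = ∑ i, μ C i * v i := by
      conv_lhs => rw [pi_eq_sum_univ' (μ C)]
      simp only [map_sum, map_smul, smul_eq_mul, v]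
    rw [← this]
    exact hf C
  have hperturb : ∀ (p r : Fin n → ℝ), (∀ C, ∑ i, μ C i * r i ≠ 0) →
      ∀ᶠ ε in nhdsWithin (0 : ℝ) (Ioi 0), ∀ C, ∑ i, μ C i * (p i + ε * r i) ≠ 0 := by
    intro p r hr
    refine Filter.eventually_all.2 fun C => ?_
    filter_upwards [eventually_add_mul_ne_zero (∑ i, μ C i * p i) (hr C)] with ε hε
    convert hε using 1
    rw [Finset.mul_sum, ← Finset.sum_add_distrib]
    exact Finset.sum_congr rfl fun i _ => by ring
  obtain ⟨δ, hδrel, hδgen⟩ := ((eventually_isRelevant_neg_norm_sq_add hx v).and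
    (hperturb (fun i => -‖x i‖ ^ 2) v hv)).exists
  set q : Fin n → ℝ := fun i => -‖x i‖ ^ 2 + δ * v i
  have hrefine : ∀ᶠ ε in nhdsWithin (0 : ℝ) (Ioi 0), ∀ σ : Finset (Fin n),
      (AffineIndependent ℝ fun i : {i // i ∈ σ} => x i) →
      IsCell x (fun i => y i + ε * q i) σ → ∃ C ∈ regularSubdivision x y, σ ⊆ C := by
    refine Filter.eventually_all.2 fun σ => ?_
    by_cases hind : AffineIndependent ℝ fun i : {i // i ∈ σ} => x i
    · exact (eventually_exists_cell_superset x y q σ hind).mono fun _ h _ => h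
    · exact Filter.Eventually.of_forall fun _ h => absurd h hind
  obtain ⟨ε, ⟨hεgen, hεref⟩, hε0⟩ :=
    (((hperturb y q hδgen).and hrefine).and self_mem_nhdsWithin).exists
  set z : Fin n → ℝ := fun i => y i + ε * q i
  have hzrel : IsRelevant x z := hy.add_mul hδrel (le_of_lt hε0)
  have hind : ∀ σ ∈ regularSubdivision x z, AffineIndependent ℝ fun i : {i // i ∈ σ} => x i := by
    intro σ hσ
    by_contra hdep
    obtain ⟨l, -, hlσ, -⟩ := ((mem_regularSubdivision x z).1 hσ).exists_affine
    exact hεgen ⟨σ, hdep⟩ ((hμ ⟨σ, hdep⟩).sum_mul_eq_zero hlσ)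
  refine ⟨regularSubdivision x z, ⟨⟨z, rfl⟩, hind⟩,
    fun σ hσ => hεref σ (hind σ hσ) ((mem_regularSubdivision x z).1 hσ), fun k => ?_⟩
  obtain ⟨σ, hσ, hk⟩ := exists_cell_mem z hdim (subset_convexHull ℝ _ (mem_range_self k))
  exact ⟨σ, hσ, (((mem_regularSubdivision x z).1 hσ).2.2 k).2 ⟨hk, hzrel k⟩⟩

end LogConcaveMLE

namespace LogConcaveMLE

/-! ### Integrals over corner simplices -/

/-- The simplex with vertices `0` and `r e_i`. -/
def cornerSimplex (ι : Type*) [Fintype ι] (r : ℝ) : Set (ι → ℝ) :=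
  {s | (∀ i, 0 ≤ s i) ∧ ∑ i, s i ≤ r}

theorem isCompact_cornerSimplex (ι : Type*) [Fintype ι] (r : ℝ) :
    IsCompact (cornerSimplex ι r) := by
  refine (isCompact_Icc (a := (0 : ι → ℝ)) (b := fun _ => r)).of_isClosed_subset ?_ ?_
  · rw [cornerSimplex, ofPred_and, ofPred_forall]
    exact (isClosed_iInter fun i => isClosed_le continuous_const (continuous_apply i)).inter
      (isClosed_le (continuous_finsetSum _ fun i _ => continuous_apply i) continuous_const)
  · exact fun s hs => ⟨hs.1, fun i =>
      (Finset.single_le_sum (fun j _ => hs.1 j) (Finset.mem_univ i)).trans hs.2⟩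

theorem measurableSet_cornerSimplex (ι : Type*) [Fintype ι] (r : ℝ) :
    MeasurableSet (cornerSimplex ι r) :=
  (isCompact_cornerSimplex ι r).isClosed.measurableSet

theorem cons_mem_cornerSimplex {m : ℕ} {r a : ℝ} {s : Fin m → ℝ} :
    (Fin.cons a s : Fin (m + 1) → ℝ) ∈ cornerSimplex (Fin (m + 1)) r ↔
      0 ≤ a ∧ s ∈ cornerSimplex (Fin m) (r - a) := by
  simp only [cornerSimplex, mem_ofPred_eq, Fin.forall_fin_succ, Fin.cons_zero, Fin.cons_succ,
    Fin.sum_univ_succ, le_sub_iff_add_le', and_assoc]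

theorem setIntegral_cornerSimplex_succ {m : ℕ} {r : ℝ} (hr : 0 ≤ r)
    {F : (Fin (m + 1) → ℝ) → ℝ} (hF : Continuous F) :
    ∫ s in cornerSimplex (Fin (m + 1)) r, F s =
      ∫ a in (0 : ℝ)..r, ∫ s in cornerSimplex (Fin m) (r - a), F (Fin.cons a s) := by
  have hmp := (volume_preserving_piFinSuccAbove (fun _ : Fin (m + 1) => ℝ) 0).symm
  set G := (cornerSimplex (Fin (m + 1)) r).indicator F with hG
  have hGi : Integrable G :=
    (integrable_indicator_iff (measurableSet_cornerSimplex _ r)).2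
      (hF.continuousOn.integrableOn_compact (isCompact_cornerSimplex _ r))
  have hcons : ∀ p : ℝ × (Fin m → ℝ),
      (MeasurableEquiv.piFinSuccAbove (fun _ : Fin (m + 1) => ℝ) 0).symm p = Fin.cons p.1 p.2 :=
    fun p => by simp [MeasurableEquiv.piFinSuccAbove, Fin.insertNthEquiv]
  have hGi' : Integrable (fun p : ℝ × (Fin m → ℝ) => G (Fin.cons p.1 p.2)) := by
    have := (hmp.integrable_comp_emb (MeasurableEquiv.measurableEmbedding _)).2 hGi
    simpa only [Function.comp_def, hcons] using this
  rw [← integral_indicator (measurableSet_cornerSimplex _ r), ← hG,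
    ← hmp.integral_comp (MeasurableEquiv.measurableEmbedding _)]
  simp only [hcons]
  rw [Measure.volume_eq_prod] at hGi' ⊢
  rw [integral_prod _ hGi', intervalIntegral.integral_of_le hr, ← integral_Icc_eq_integral_Ioc,
    ← integral_indicator measurableSet_Icc]
  refine integral_congr_ae (Filter.Eventually.of_forall fun a => ?_)
  dsimp only
  by_cases ha : a ∈ Icc 0 r
  · rw [indicator_of_mem ha, ← integral_indicator (measurableSet_cornerSimplex _ _)]
    refine integral_congr_ae (Filter.Eventually.of_forall fun s => ?_)
    by_cases hs : s ∈ cornerSimplex (Fin m) (r - a)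
    · simp only [hG, indicator_of_mem hs]
      rw [indicator_of_mem (cons_mem_cornerSimplex.2 ⟨ha.1, hs⟩)]
    · simp only [hG, indicator_of_notMem hs]
      rw [indicator_of_notMem fun h => hs (cons_mem_cornerSimplex.1 h).2]
  · rw [indicator_of_notMem ha]
    refine integral_eq_zero_of_ae (Filter.Eventually.of_forall fun s => ?_)
    refine indicator_of_notMem (fun h => ha ?_) _
    obtain ⟨h0, h1, h2⟩ := cons_mem_cornerSimplex.1 h
    exact ⟨h0, sub_nonneg.1 ((Finset.sum_nonneg fun i _ => h1 i).trans h2)⟩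

theorem integral_cornerSimplex_one (m : ℕ) : ∀ {r : ℝ}, 0 ≤ r →
    ∫ _ in cornerSimplex (Fin m) r, (1 : ℝ) = r ^ m / m.factorial := by
  induction m with
  | zero =>
    intro r hr
    have : cornerSimplex (Fin 0) r = univ := by ext; simp [cornerSimplex, hr]
    simp [this, Measure.real, volume_pi]
  | succ m ih =>
    intro r hr
    rw [setIntegral_cornerSimplex_succ hr continuous_const]
    have : ∀ a ∈ uIcc 0 r, ∫ _ in cornerSimplex (Fin m) (r - a), (1 : ℝ)
        = (r - a) ^ m / m.factorial := fun a ha => by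
      rw [uIcc_of_le hr] at ha
      exact ih (sub_nonneg.2 ha.2)
    rw [intervalIntegral.integral_congr this, intervalIntegral.integral_div,
      intervalIntegral.integral_comp_sub_left (fun a => a ^ m)]
    simp only [sub_self, sub_zero, integral_pow, Nat.factorial_succ, Nat.cast_mul, Nat.cast_add,
      Nat.cast_one]
    field_simp
    simp

/-! ### The closed formula for `H` -/

theorem prod_erase_eq_prod_ite {ι : Type*} [Fintype ι] [DecidableEq ι] (j : ι) (g : ι → ℝ) :
    ∏ k ∈ Finset.univ.erase j, g k = ∏ k, if k = j then 1 else g k := by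
  rw [← Finset.filter_ne', Finset.prod_filter]
  exact Finset.prod_congr rfl fun k _ => ite_not _ _ _

/-- Partial fractions: the divided difference of the constant `1` at the nodes `0, 0, u_j`. -/
theorem partial_fractions {ι : Type*} [Fintype ι] [DecidableEq ι] [Nonempty ι] {u : ι → ℝ}
    (h0 : ∀ j, u j ≠ 0) (hu : Function.Injective u) :
    (-1) ^ Fintype.card ι * ((∑ j, (u j)⁻¹) / ∏ j, u j) +
      ∑ j, 1 / ((u j) ^ 2 * ∏ k ∈ Finset.univ.erase j, (u j - u k)) = 0 := by
  set D : ι → ℝ := fun j => ∏ k ∈ Finset.univ.erase j, (u j - u k) with hD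
  have hDne : ∀ j, D j ≠ 0 := fun j => Finset.prod_ne_zero_iff.2 fun k hk =>
    sub_ne_zero.2 (hu.ne (Finset.ne_of_mem_erase hk).symm)
  -- The Lagrange basis polynomials at the nodes `u` sum to `1`. Division by `∏ (X - u k)` gives a
  -- partial fraction identity near `0`, whose derivative at `0` is the claim.
  have hlag : ∀ X : ℝ, ∑ j, (D j)⁻¹ * ∏ k ∈ Finset.univ.erase j, (X - u k) = 1 := by
    intro X
    have := congrArg (Polynomial.eval X)
      (Lagrange.sum_basis (s := Finset.univ) (v := u) hu.injOn Finset.univ_nonempty)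
    rw [Polynomial.eval_finsetSum, Polynomial.eval_one] at this
    rw [← this]
    refine Finset.sum_congr rfl fun j _ => ?_
    simp only [Lagrange.basis, Lagrange.basisDivisor, Polynomial.eval_prod, Polynomial.eval_mul,
      Polynomial.eval_C, Polynomial.eval_sub, Polynomial.eval_X, Finset.prod_mul_distrib,
      Finset.prod_inv_distrib, hD]
  have hfrac : ∀ᶠ X in nhds (0 : ℝ), ∑ j, (D j)⁻¹ * (X - u j)⁻¹ = (∏ k, (X - u k))⁻¹ := by
    have hne : ∀ᶠ X in nhds (0 : ℝ), ∀ j, X - u j ≠ 0 := by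
      refine Filter.eventually_all.2 fun j => ?_
      have hc : Filter.Tendsto (fun X : ℝ => X - u j) (nhds 0) (nhds (0 - u j)) :=
        (continuous_id.sub continuous_const).tendsto 0
      exact hc.eventually_ne (by simpa using h0 j)
    filter_upwards [hne] with X hX
    refine eq_inv_of_mul_eq_one_left ?_
    rw [← hlag X, Finset.sum_mul]
    refine Finset.sum_congr rfl fun j _ => ?_
    rw [← Finset.mul_prod_erase Finset.univ _ (Finset.mem_univ j)]
    have := hX j
    field_simp
  have hd1 : HasDerivAt (fun X : ℝ => ∑ j, (D j)⁻¹ * (X - u j)⁻¹)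
      (∑ j, (D j)⁻¹ * (-1 / (0 - u j) ^ 2)) 0 := by
    refine HasDerivAt.fun_sum fun j _ => ?_
    exact (((hasDerivAt_id (0 : ℝ)).sub_const (u j)).inv (by simpa using h0 j)).const_mul _
  have hprod : ∏ k, (0 - u k) ≠ 0 := Finset.prod_ne_zero_iff.2 fun k _ => by simpa using h0 k
  have hd2 : HasDerivAt (fun X : ℝ => (∏ k, (X - u k))⁻¹)
      (-(∑ j, (∏ k ∈ Finset.univ.erase j, (0 - u k)) • (1 : ℝ)) / (∏ k, (0 - u k)) ^ 2) 0 :=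
    (HasDerivAt.fun_finsetProd fun k _ => (hasDerivAt_id (0 : ℝ)).sub_const (u k)).inv hprod
  have heq := hd1.unique (hd2.congr_of_eventuallyEq hfrac)
  have hP : ∏ k, (0 - u k) = (-1) ^ Fintype.card ι * ∏ k, u k := by
    simp [Finset.prod_neg, Finset.card_univ]
  have hE : ∀ j, ∏ k ∈ Finset.univ.erase j, (0 - u k) = (∏ k, (0 - u k)) * -(u j)⁻¹ := fun j => by
    rw [← Finset.mul_prod_erase Finset.univ (fun k => 0 - u k) (Finset.mem_univ j)]
    have := h0 j
    field_simp
    ring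
  have hl : ∑ j, (D j)⁻¹ * (-1 / (0 - u j) ^ 2) = -∑ j, 1 / ((u j) ^ 2 * D j) := by
    rw [← Finset.sum_neg_distrib]
    refine Finset.sum_congr rfl fun j _ => ?_
    have := h0 j
    have := hDne j
    field_simp
    ring
  have hs : ((-1 : ℝ) ^ Fintype.card ι)⁻¹ = (-1) ^ Fintype.card ι := by
    rw [← inv_pow]
    norm_num
  rw [hl] at heq
  have hr : -(∑ j, (∏ k ∈ Finset.univ.erase j, (0 - u k)) • (1 : ℝ)) / (∏ k, (0 - u k)) ^ 2
      = (∏ k, (0 - u k))⁻¹ * ∑ j, (u j)⁻¹ := by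
    simp only [hE, smul_eq_mul, mul_one, ← Finset.mul_sum, Finset.sum_neg_distrib]
    field_simp
  rw [hr, hP, mul_inv, hs] at heq
  have : ∑ j, 1 / ((u j) ^ 2 * ∏ k ∈ Finset.univ.erase j, (u j - u k))
      = ∑ j, 1 / ((u j) ^ 2 * D j) := rfl
  rw [this]
  linear_combination -heq

/-- The formula for `H`, homogenized by the size `r` of the simplex. -/
noncomputable def scaledHFormula {ι : Type*} [Fintype ι] [DecidableEq ι] (u : ι → ℝ) (r : ℝ) : ℝ :=
  (-1) ^ Fintype.card ι * ((r + ∑ j, (u j)⁻¹) / ∏ j, u j) +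
    ∑ j, Real.exp (r * u j) / ((u j) ^ 2 * ∏ k ∈ Finset.univ.erase j, (u j - u k))

theorem scaledHFormula_one {ι : Type} [Fintype ι] [DecidableEq ι] (u : ι → ℝ) :
    scaledHFormula u 1 = HFormula u := by
  simp [scaledHFormula, HFormula]

theorem scaledHFormula_zero {ι : Type*} [Fintype ι] [DecidableEq ι] [Nonempty ι] {u : ι → ℝ}
    (h0 : ∀ j, u j ≠ 0) (hu : Function.Injective u) : scaledHFormula u 0 = 0 := by
  simpa [scaledHFormula] using partial_fractions h0 hu

/-- This linear differential equation is the one satisfied by the convolution of `exp (a u_0)` with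
the formula for the remaining variables. -/
theorem hasDerivAt_scaledHFormula {m : ℕ} {u : Fin (m + 1) → ℝ} (h0 : ∀ j, u j ≠ 0)
    (hu : Function.Injective u) (r : ℝ) :
    HasDerivAt (scaledHFormula u)
      (u 0 * scaledHFormula u r + scaledHFormula (fun j : Fin m => u j.succ) r) r := by
  have hd : HasDerivAt (scaledHFormula u)
      ((-1) ^ Fintype.card (Fin (m + 1)) * (1 / ∏ j, u j) +
        ∑ j, Real.exp (r * u j) * (1 * u j) /
          ((u j) ^ 2 * ∏ k ∈ Finset.univ.erase j, (u j - u k))) r := by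
    refine HasDerivAt.add ?_ (HasDerivAt.fun_sum fun j _ => ?_)
    · exact (((hasDerivAt_id r).add_const _).div_const _).const_mul _
    · exact (((hasDerivAt_id r).mul_const (u j)).exp).div_const _
  convert hd using 1
  simp only [scaledHFormula, prod_erase_eq_prod_ite, Fin.sum_univ_succ, Fin.prod_univ_succ,
    Fintype.card_fin, Fin.succ_ne_zero, if_true, if_false, (Fin.succ_ne_zero _).symm,
    Fin.succ_inj, one_mul]
  have hP : ∏ i : Fin m, u i.succ ≠ 0 := Finset.prod_ne_zero_iff.2 fun i _ => h0 _
  have hu0 := h0 0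
  have hterm : ∀ i : Fin m,
      Real.exp (r * u i.succ) * u i.succ / (u i.succ ^ 2 *
        ((u i.succ - u 0) * ∏ k : Fin m, if k = i then 1 else u i.succ - u k.succ))
      = u 0 * (Real.exp (r * u i.succ) / (u i.succ ^ 2 *
        ((u i.succ - u 0) * ∏ k : Fin m, if k = i then 1 else u i.succ - u k.succ)))
        + Real.exp (r * u i.succ) / (u i.succ ^ 2 *
          ∏ k : Fin m, if k = i then 1 else u i.succ - u k.succ) := fun i => by
    have h1 : u i.succ - u 0 ≠ 0 := sub_ne_zero.2 (hu.ne (Fin.succ_ne_zero i))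
    have h2 : ∏ k : Fin m, (if k = i then 1 else u i.succ - u k.succ) ≠ 0 :=
      Finset.prod_ne_zero_iff.2 fun k _ => by
        split_ifs with h
        · exact one_ne_zero
        · exact sub_ne_zero.2 (hu.ne fun h' => h (Fin.succ_injective _ h').symm)
    have h3 := h0 i.succ
    field_simp
    ring
  rw [Finset.sum_congr rfl fun i _ => hterm i, Finset.sum_add_distrib, ← Finset.mul_sum]
  field_simp
  ring

/-- Slicing along the first coordinate turns the integral into that convolution. The differential
equation supplies the antiderivative `-exp (a u_0) S(r - a)`, with `S` the formula for `u`, and its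
value at `a = r` vanishes by partial fractions. -/
theorem integral_cornerSimplex_eq_scaledHFormula (m : ℕ) : ∀ {u : Fin m → ℝ}, (∀ j, u j ≠ 0) →
    Function.Injective u → ∀ {r : ℝ}, 0 ≤ r →
    ∫ s in cornerSimplex (Fin m) r, (r - ∑ i, s i) * Real.exp (∑ i, s i * u i) =
      scaledHFormula u r := by
  induction m with
  | zero =>
    intro u _ _ r hr
    have : cornerSimplex (Fin 0) r = univ := by ext; simp [cornerSimplex, hr]
    simp [this, Measure.real, volume_pi, scaledHFormula]
  | succ m ih =>
    intro u h0 hu r hr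
    rw [setIntegral_cornerSimplex_succ hr (by fun_prop)]
    have hin : ∀ a ∈ uIcc 0 r, (∫ s in cornerSimplex (Fin m) (r - a),
        (r - ∑ i, (Fin.cons a s : Fin (m + 1) → ℝ) i) *
          Real.exp (∑ i, (Fin.cons a s : Fin (m + 1) → ℝ) i * u i))
        = Real.exp (a * u 0) * scaledHFormula (fun j : Fin m => u j.succ) (r - a) := by
      intro a ha
      rw [uIcc_of_le hr] at ha
      rw [← ih (fun j => h0 _) (hu.comp (Fin.succ_injective _)) (sub_nonneg.2 ha.2),
        ← integral_const_mul]
      congr 1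
      ext s
      simp only [Fin.sum_univ_succ, Fin.cons_zero, Fin.cons_succ, Real.exp_add]
      ring
    rw [intervalIntegral.integral_congr hin]
    have hcont : Continuous (scaledHFormula fun j : Fin m => u j.succ) := by
      unfold scaledHFormula
      fun_prop
    rw [intervalIntegral.integral_eq_sub_of_hasDerivAt
      (f := fun a => -(Real.exp (a * u 0) * scaledHFormula u (r - a))) (fun a _ => ?_)
      (Continuous.intervalIntegrable (by fun_prop) _ _)]
    · simp [scaledHFormula_zero h0 hu]
    · have h1 := ((hasDerivAt_id a).mul_const (u 0)).exp
      have h2 := (hasDerivAt_scaledHFormula h0 hu (r - a)).comp a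
        ((hasDerivAt_id a).const_sub r)
      refine HasDerivAt.congr_deriv (h1.mul h2).neg ?_
      simp only [id, Function.comp_apply]
      ring

theorem HFormula_comp_equiv {ι κ : Type} [Fintype ι] [DecidableEq ι] [Fintype κ] [DecidableEq κ]
    (e : κ ≃ ι) (u : ι → ℝ) : HFormula (u ∘ e) = HFormula u := by
  simp only [HFormula, prod_erase_eq_prod_ite, Function.comp_apply, Fintype.card_congr e]
  rw [Equiv.sum_comp e fun j => (u j)⁻¹, Equiv.prod_comp e u,
    ← Equiv.sum_comp e fun j => Real.exp (u j) /
      (u j ^ 2 * ∏ k, if k = j then 1 else u j - u k)]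
  congr 1
  refine Finset.sum_congr rfl fun j _ => ?_
  rw [← Equiv.prod_comp e fun k => if k = e j then 1 else u (e j) - u k]
  simp only [e.apply_eq_iff_eq]

theorem setIntegral_cornerSimplex_comp_equiv {ι κ : Type*} [Fintype ι] [Fintype κ] (e : κ ≃ ι)
    (r : ℝ) (F : (κ → ℝ) → ℝ) :
    ∫ s in cornerSimplex ι r, F (fun i => s (e i)) = ∫ s in cornerSimplex κ r, F s := by
  have hmp := volume_measurePreserving_piCongrLeft (fun _ : ι => ℝ) e
  have happ : ∀ (s : κ → ℝ) (i : κ),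
      MeasurableEquiv.piCongrLeft (fun _ : ι => ℝ) e s (e i) = s i := fun s i =>
    Equiv.piCongrLeft_apply_apply (fun _ : ι => ℝ) e s i
  rw [← hmp.setIntegral_preimage_emb (MeasurableEquiv.measurableEmbedding _)]
  simp only [happ]
  congr 2
  ext s
  simp only [cornerSimplex, mem_preimage, mem_ofPred_eq]
  rw [← e.forall_congr_right, ← e.sum_comp]
  simp only [happ]

theorem volume_real_cornerSimplex (ι : Type*) [Fintype ι] :
    volume.real (cornerSimplex ι 1) = ((Fintype.card ι).factorial : ℝ)⁻¹ := by
  have h := setIntegral_cornerSimplex_comp_equiv (Fintype.equivFin ι).symm 1 fun _ => 1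
  rw [integral_cornerSimplex_one _ zero_le_one] at h
  simpa using h

theorem HFormula_eq_integral {ι : Type} [Fintype ι] [DecidableEq ι] {u : ι → ℝ}
    (h0 : ∀ j, u j ≠ 0) (hu : Function.Injective u) :
    HFormula u = ∫ s in cornerSimplex ι 1, (1 - ∑ i, s i) * Real.exp (∑ i, s i * u i) := by
  set e := (Fintype.equivFin ι).symm
  rw [← HFormula_comp_equiv e, ← scaledHFormula_one,
    ← integral_cornerSimplex_eq_scaledHFormula _ (u := u ∘ e) (fun j => h0 (e j)) (hu.comp e.injective)
      zero_le_one, ← setIntegral_cornerSimplex_comp_equiv e]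
  congr 1
  ext s
  rw [e.sum_comp]
  congr 2
  exact e.sum_comp fun i => s i * u i

/-- The integral is continuous in `u` and agrees with the closed formula on a dense set, so it is
the continuous extension. -/
theorem H_eq_integral {ι : Type} [Fintype ι] [DecidableEq ι] (u : ι → ℝ) :
    H u = ∫ s in cornerSimplex ι 1, (1 - ∑ i, s i) * Real.exp (∑ i, s i * u i) := by
  have hcont : Continuous fun u : ι → ℝ =>
      ∫ s in cornerSimplex ι 1, (1 - ∑ i, s i) * Real.exp (∑ i, s i * u i) :=
    continuous_parametric_integral_of_continuous
      (f := fun (u s : ι → ℝ) => (1 - ∑ i, s i) * Real.exp (∑ i, s i * u i))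
      (by fun_prop) (isCompact_cornerSimplex ι 1)
  refine extendFrom_eq ?_ ?_
  -- Density: moving `u` along a vector with nonzero, distinct coordinates makes all coordinates
  -- nonzero and distinct for small `ε > 0`.
  · set v : ι → ℝ := fun i => (Fintype.equivFin ι i : ℝ) + 1
    have hv0 : ∀ i, v i ≠ 0 := fun i => by positivity
    have hv : Function.Injective v := fun i j hij => by
      simpa [v, Fin.val_inj] using hij
    have htend : Filter.Tendsto (fun ε : ℝ => fun i => u i + ε * v i) (nhdsWithin 0 (Ioi 0))
        (nhds u) := by
      have hc : Continuous fun ε : ℝ => fun i => u i + ε * v i := by fun_prop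
      have := hc.tendsto 0
      simp only [zero_mul, add_zero] at this
      exact this.mono_left nhdsWithin_le_nhds
    refine mem_closure_of_tendsto htend ?_
    have h1 : ∀ᶠ ε in nhdsWithin (0 : ℝ) (Ioi 0), ∀ j, u j + ε * v j ≠ 0 :=
      Filter.eventually_all.2 fun j => eventually_add_mul_ne_zero _ (hv0 j)
    have h2 : ∀ᶠ ε in nhdsWithin (0 : ℝ) (Ioi 0), ∀ j k, j ≠ k →
        u j - u k + ε * (v j - v k) ≠ 0 := by
      refine Filter.eventually_all.2 fun j => Filter.eventually_all.2 fun k => ?_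
      by_cases h : j = k
      · simp [h]
      · exact (eventually_add_mul_ne_zero _ (sub_ne_zero.2 (hv.ne h))).mono fun _ h _ => h
    filter_upwards [h1, h2] with ε h1 h2
    refine ⟨h1, fun j k hjk => ?_⟩
    by_contra hne
    refine h2 j k hne ?_
    dsimp only at hjk
    linarith
  · refine ((hcont.tendsto u).mono_left nhdsWithin_le_nhds).congr' ?_
    filter_upwards [self_mem_nhdsWithin] with w hw
    exact (HFormula_eq_integral hw.1 hw.2).symm

end LogConcaveMLE

namespace LogConcaveMLE

variable {d n : ℕ}

/-! ### Integrals over full-dimensional simplices -/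

section Chart

variable {ι κ : Type*} [Fintype ι] (b : AffineBasis κ ℝ (Pt d)) (k : κ)
  (e : ι ≃ {j // j ≠ k})

/-- The affine chart that maps the corner simplex onto the simplex spanned by `b`, with the
origin going to the vertex `b k`. -/
noncomputable def chart (s : ι → ℝ) : Pt d :=
  b k + ((b.basisOf k).reindex e.symm).equivFun.symm s

theorem affineMap_chart (l : Pt d →ᵃ[ℝ] ℝ) (s : ι → ℝ) :
    l (chart b k e s) = l (b k) + ∑ i, s i * (l (b (e i)) - l (b k)) := by
  rw [chart, add_comm, ← vadd_eq_add, AffineMap.map_vadd, vadd_eq_add, add_comm,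
    Module.Basis.equivFun_symm_apply, map_sum]
  congr 1
  refine Finset.sum_congr rfl fun i _ => ?_
  rw [map_smul, Module.Basis.reindex_apply, AffineBasis.basisOf_apply, AffineMap.linearMap_vsub]
  simp

theorem coord_chart_self (s : ι → ℝ) : b.coord k (chart b k e s) = 1 - ∑ i, s i := by
  have h : ∀ i, b.coord k (b (e i)) = 0 := fun i => b.coord_apply_ne (e i).2.symm
  rw [affineMap_chart]
  simp [h, sub_eq_add_neg]

theorem coord_chart_ne (s : ι → ℝ) (i : ι) : b.coord (e i) (chart b k e s) = s i := by
  classical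
  rw [affineMap_chart, b.coord_apply_ne (e i).2, Finset.sum_eq_single i]
  · simp
  · intro j _ hj
    rw [b.coord_apply_ne]
    · simp
    · exact fun h => hj (e.injective (Subtype.ext h.symm))
  · simp

theorem chart_preimage : chart b k e ⁻¹' convexHull ℝ (range b) = cornerSimplex ι 1 := by
  ext s
  rw [mem_preimage, b.convexHull_eq_nonneg_coord]
  simp only [mem_ofPred_eq, cornerSimplex]
  constructor
  · intro h
    refine ⟨fun i => ?_, ?_⟩
    · rw [← coord_chart_ne b k e s i]
      exact h _
    · have := h k
      rw [coord_chart_self] at this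
      linarith
  · rintro ⟨h0, h1⟩ j
    by_cases hj : j = k
    · rw [hj, coord_chart_self]
      linarith
    · obtain ⟨i, hi⟩ := e.surjective ⟨j, hj⟩
      have := coord_chart_ne b k e s i
      rw [hi] at this
      rw [this]
      exact h0 i

/-- By uniqueness of Haar measure the chart rescales Lebesgue measure by a constant. No determinant
is needed: `integral_convexHull_eq` identifies the constant by testing on `g = 1`. -/
theorem exists_integral_convexHull_eq_mul : ∃ c : ℝ, ∀ g : Pt d → ℝ,
    ∫ t in convexHull ℝ (range b), g t = c * ∫ s in cornerSimplex ι 1, g (chart b k e s) := by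
  set A := ((b.basisOf k).reindex e.symm).equivFun.symm.toContinuousLinearEquiv with hA
  set φ := (A.toHomeomorph.trans (Homeomorph.addLeft (b k))).toMeasurableEquiv with hφ
  have hφc : ∀ s, φ s = chart b k e s := fun s => rfl
  have hhaar : (Measure.map A (volume : Measure (ι → ℝ))).IsAddHaarMeasure :=
    A.isAddHaarMeasure_map _
  obtain ⟨c, hc0, hc⟩ : ∃ c : NNReal, c ≠ 0 ∧
      Measure.map A (volume : Measure (ι → ℝ)) = c • (volume : Measure (Pt d)) := by
    refine ⟨_, ?_, Measure.isAddLeftInvariant_eq_smul _ volume⟩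
    exact (Measure.addHaarScalarFactor_pos_of_isAddHaarMeasure _ _).ne'
  have hmap : Measure.map φ (volume : Measure (ι → ℝ)) = c • (volume : Measure (Pt d)) := by
    have hcomp : (φ : (ι → ℝ) → Pt d) = (fun t => b k + t) ∘ A := rfl
    rw [hcomp, ← Measure.map_map (measurable_const_add _) A.continuous.measurable, hc,
      Measure.map_smul, map_add_left_eq_self]
  refine ⟨(c : ℝ)⁻¹, fun g => ?_⟩
  have h := setIntegral_map_equiv (μ := (volume : Measure (ι → ℝ))) φ g (convexHull ℝ (range b))
  have hpre : φ ⁻¹' convexHull ℝ (range b) = cornerSimplex ι 1 := chart_preimage b k e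
  rw [hmap, hpre, Measure.restrict_smul, integral_smul_nnreal_measure] at h
  simp only [hφc] at h
  rw [← h, NNReal.smul_def, smul_eq_mul, inv_mul_cancel_left₀ (NNReal.coe_ne_zero.2 hc0)]

theorem integral_convexHull_eq (g : Pt d → ℝ) :
    ∫ t in convexHull ℝ (range b), g t = d.factorial * volume.real (convexHull ℝ (range b)) *
      ∫ s in cornerSimplex ι 1, g (chart b k e s) := by
  obtain ⟨c, hc⟩ := exists_integral_convexHull_eq_mul b k e
  have hcard : Fintype.card ι = d := by
    rw [← Module.finrank_eq_card_basis ((b.basisOf k).reindex e.symm)]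
    simp
  have h1 := hc fun _ => 1
  simp only [integral_const, smul_eq_mul, mul_one, measureReal_restrict_apply_univ,
    volume_real_cornerSimplex, hcard] at h1
  rw [hc, h1]
  field_simp

end Chart

theorem range_simplexBasis {x : Fin n → Pt d} {σ : Finset (Fin n)}
    (hind : AffineIndependent ℝ fun i : {i // i ∈ σ} => x i)
    (hspan : affineSpan ℝ (x '' (σ : Set (Fin n))) = ⊤) :
    range (simplexBasis hind hspan) = x '' (σ : Set (Fin n)) := by
  rw [image_eq_range]
  rfl

/-- The summands of the weights are integrals of barycentric coordinates. -/
theorem weight_summand_eq_integral {x : Fin n → Pt d} {σ : Finset (Fin n)}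
    (hind : AffineIndependent ℝ fun i : {i // i ∈ σ} => x i)
    (hspan : affineSpan ℝ (x '' (σ : Set (Fin n))) = ⊤) (y : Fin n → ℝ)
    {k : Fin n} (hk : k ∈ σ) :
    normVol x σ * Real.exp (y k) * H (fun i : {i // i ∈ σ.erase k} => y i - y k) =
      ∫ t in convexHull ℝ (x '' (σ : Set (Fin n))),
        (simplexBasis hind hspan).coord ⟨k, hk⟩ t *
          Real.exp (interp (simplexBasis hind hspan) (fun i => y i) t) := by
  set b := simplexBasis hind hspan
  let e : {i // i ∈ σ.erase k} ≃ {j : {i // i ∈ σ} // j ≠ ⟨k, hk⟩} :=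
    { toFun := fun i => ⟨⟨i, Finset.mem_of_mem_erase i.2⟩,
        fun h => Finset.ne_of_mem_erase i.2 (congrArg Subtype.val h)⟩
      invFun := fun j => ⟨j, Finset.mem_erase.2 ⟨fun h => j.2 (Subtype.ext h), j.1.2⟩⟩
      left_inv := fun _ => rfl
      right_inv := fun _ => rfl }
  rw [← range_simplexBasis hind hspan, integral_convexHull_eq b ⟨k, hk⟩ e,
    range_simplexBasis hind hspan, normVol, H_eq_integral, mul_assoc, ← integral_const_mul]
  congr 2
  ext s
  rw [coord_chart_self, affineMap_chart, interp_basis, Real.exp_add]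
  simp only [interp_basis]
  change _ = (1 - ∑ i, s i) *
    (Real.exp (y k) * Real.exp (∑ i : {i // i ∈ σ.erase k}, s i * (y i - y k)))
  ring

theorem integral_coord_mul_exp_pos {x : Fin n → Pt d} {σ : Finset (Fin n)}
    (hind : AffineIndependent ℝ fun i : {i // i ∈ σ} => x i)
    (hspan : affineSpan ℝ (x '' (σ : Set (Fin n))) = ⊤) (i : {i // i ∈ σ}) (l : Pt d →ᵃ[ℝ] ℝ) :
    0 < ∫ t in convexHull ℝ (x '' (σ : Set (Fin n))),
        (simplexBasis hind hspan).coord i t * Real.exp (l t) := by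
  set b := simplexBasis hind hspan
  have hcont : Continuous fun t => b.coord i t * Real.exp (l t) :=
    (continuous_affineMap _).mul (continuous_affineMap l).rexp
  rw [setIntegral_pos_iff_support_of_nonneg_ae]
  · have hne := interior_convexHull_nonempty_iff_affineSpan_eq_top.2 hspan
    refine lt_of_lt_of_le (isOpen_interior.measure_pos volume hne) (measure_mono fun t ht => ?_)
    refine ⟨?_, interior_subset ht⟩
    rw [← range_simplexBasis hind hspan, b.interior_convexHull] at ht
    exact (mul_pos (ht i) (Real.exp_pos _)).ne'
  · filter_upwards [ae_restrict_mem (measurableSet_convexHull_image x _)] with t ht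
    rw [← range_simplexBasis hind hspan, b.convexHull_eq_nonneg_coord] at ht
    exact mul_nonneg (ht i) (Real.exp_pos _).le
  · exact hcont.continuousOn.integrableOn_compact (isCompact_convexHull_image x _)

end LogConcaveMLE

namespace LogConcaveMLE

variable {d n : ℕ}

/-! ### Triangulations on which the tent function is linear -/

/-- A triangulation of the point configuration on whose simplices the tent function with heights
`y` interpolates `y`. -/
structure IsLinearizing (x : Fin n → Pt d) (y : Fin n → ℝ) (Δ : Finset (Finset (Fin n))) :
    Prop where
  ind : ∀ σ ∈ Δ, AffineIndependent ℝ fun i : {i // i ∈ σ} => x i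
  span : ∀ σ ∈ Δ, affineSpan ℝ (x '' (σ : Set (Fin n))) = ⊤
  union : ⋃ σ : Δ, convexHull ℝ (x '' ((σ : Finset (Fin n)) : Set (Fin n))) = hull x
  disjoint : ∀ σ ∈ Δ, ∀ τ ∈ Δ, σ ≠ τ → AEDisjoint volume
    (convexHull ℝ (x '' (σ : Set (Fin n)))) (convexHull ℝ (x '' (τ : Set (Fin n))))
  tent_eq : ∀ (σ) (hσ : σ ∈ Δ), ∀ t ∈ convexHull ℝ (x '' (σ : Set (Fin n))),
    tent x y t = interp (simplexBasis (ind σ hσ) (span σ hσ)) (fun i => y i) t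

/-- Refinement places each simplex inside a linearity region of the tent; relevance makes the tent
take the values `y` at the vertices. -/
theorem IsRegularTriangulation.isLinearizing {x : Fin n → Pt d}
    (hdim : affineSpan ℝ (range x) = ⊤) {y : Fin n → ℝ} (hy : IsRelevant x y)
    {Δ : Finset (Finset (Fin n))} (hΔ : IsRegularTriangulation x Δ)
    (href : Refines Δ (regularSubdivision x y)) : IsLinearizing x y Δ := by
  obtain ⟨⟨z, rfl⟩, hind⟩ := hΔ
  have hcell : ∀ σ ∈ regularSubdivision x z, IsCell x z σ := fun σ hσ =>
    (mem_regularSubdivision x z).1 hσ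
  refine ⟨hind, fun σ hσ => (hcell σ hσ).affineSpan_eq_top, iUnion_cells z hdim,
    fun σ hσ τ hτ h => aedisjoint_cells x z (hcell σ hσ) (hcell τ hτ) h, fun σ hσ t ht => ?_⟩
  obtain ⟨C, hC, hσC⟩ := href σ hσ
  obtain ⟨-, ⟨l, hl⟩, -⟩ := (mem_regularSubdivision x y).1 hC
  have hloc : ∀ t ∈ convexHull ℝ (x '' (σ : Set (Fin n))), tent x y t = l t := fun t ht => by
    have : t ∈ convexHull ℝ (x '' (C : Set (Fin n))) :=
      convexHull_mono (image_mono (Finset.coe_subset.2 hσC)) ht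
    rw [hl] at this
    exact this.2
  rw [hloc t ht, eq_interp (simplexBasis (hind σ hσ) (hcell σ hσ).affineSpan_eq_top) l]
  congr 2
  ext i
  rw [simplexBasis_apply, ← hloc _ (subset_convexHull ℝ _ (mem_image_of_mem x i.2)), hy i]

/-! ### Concavity and the Gibbs inequality on one simplex -/

section Simplex

variable {x : Fin n → Pt d} {σ : Finset (Fin n)}
  (hind : AffineIndependent ℝ fun i : {i // i ∈ σ} => x i)
  (hspan : affineSpan ℝ (x '' (σ : Set (Fin n))) = ⊤)

theorem coord_nonneg {t : Pt d} (ht : t ∈ convexHull ℝ (x '' (σ : Set (Fin n))))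
    (i : {i // i ∈ σ}) : 0 ≤ (simplexBasis hind hspan).coord i t := by
  rw [← range_simplexBasis hind hspan, AffineBasis.convexHull_eq_nonneg_coord] at ht
  exact ht i

/-- A concave function dominates the linear interpolation of its values on a simplex. -/
theorem interp_le_of_concaveOn {D : Set (Pt d)} {g : Pt d → ℝ} (hg : ConcaveOn ℝ D g)
    {c : {i // i ∈ σ} → ℝ} (hD : ∀ i : {i // i ∈ σ}, x i ∈ D) (hc : ∀ i, c i ≤ g (x i))
    {t : Pt d} (ht : t ∈ convexHull ℝ (x '' (σ : Set (Fin n)))) :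
    t ∈ D ∧ interp (simplexBasis hind hspan) c t ≤ g t := by
  set b := simplexBasis hind hspan
  have h0 := coord_nonneg hind hspan ht
  have h1 := b.sum_coord_apply_eq_one t
  have ht' := b.linear_combination_coord_eq_self t
  constructor
  · rw [← ht']
    exact hg.1.sum_mem (fun i _ => h0 i) h1 fun i _ => hD i
  · rw [interp_apply]
    refine (Finset.sum_le_sum fun i _ => mul_le_mul_of_nonneg_left (hc i) (h0 i)).trans ?_
    have := hg.le_map_sum (t := Finset.univ) (fun i _ => h0 i) h1 (p := b) fun i _ => hD i
    rw [ht'] at this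
    exact this

theorem integrableOn_simplex {g : Pt d → ℝ} (hg : Continuous g) :
    IntegrableOn g (convexHull ℝ (x '' (σ : Set (Fin n)))) :=
  hg.continuousOn.integrableOn_compact (isCompact_convexHull_image x _)

/-- The Gibbs inequality on a simplex. -/
theorem integral_mul_exp_sub_le (l l' : Pt d →ᵃ[ℝ] ℝ) {F : Pt d → ℝ}
    (hF : IntegrableOn F (convexHull ℝ (x '' (σ : Set (Fin n)))))
    (hle : ∀ t ∈ convexHull ℝ (x '' (σ : Set (Fin n))), Real.exp (l' t) ≤ F t) :
    ∫ t in convexHull ℝ (x '' (σ : Set (Fin n))), l' t * Real.exp (l t) ≤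
      (∫ t in convexHull ℝ (x '' (σ : Set (Fin n))), l t * Real.exp (l t)) -
      (∫ t in convexHull ℝ (x '' (σ : Set (Fin n))), Real.exp (l t)) +
      ∫ t in convexHull ℝ (x '' (σ : Set (Fin n))), F t := by
  have hl := continuous_affineMap l
  have hl' := continuous_affineMap l'
  have i1 := integrableOn_simplex (x := x) (σ := σ) (g := fun t => l t * Real.exp (l t))
    (hl.mul hl.rexp)
  have i2 := integrableOn_simplex (x := x) (σ := σ) hl.rexp
  have i3 := integrableOn_simplex (x := x) (σ := σ) (g := fun t => l' t * Real.exp (l t))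
    (hl'.mul hl.rexp)
  have i12 : IntegrableOn (fun t => l t * Real.exp (l t) - Real.exp (l t))
    (convexHull ℝ (x '' (σ : Set (Fin n)))) := i1.sub i2
  rw [← integral_sub i1 i2, ← integral_add i12 hF]
  refine setIntegral_mono_on i3 (i12.add hF) (measurableSet_convexHull_image x _)
    fun t ht => ?_
  have h1 := hle t ht
  -- This is `1 + s ≤ exp s` at `s = l' - l`, multiplied by `exp l`.
  have h2 := mul_le_mul_of_nonneg_left (Real.add_one_le_exp (l' t - l t)) (Real.exp_pos (l t)).le
  rw [← Real.exp_add, add_sub_cancel] at h2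
  nlinarith

/-- Where `l ≠ l'` the pointwise inequality is strict. If the functions differ, this is almost all
of the simplex, which has positive volume. -/
theorem eq_of_integral_mul_exp_sub_eq
    (hspan : affineSpan ℝ (x '' (σ : Set (Fin n))) = ⊤) (l l' : Pt d →ᵃ[ℝ] ℝ) {F : Pt d → ℝ}
    (hF : IntegrableOn F (convexHull ℝ (x '' (σ : Set (Fin n)))))
    (hle : ∀ t ∈ convexHull ℝ (x '' (σ : Set (Fin n))), Real.exp (l' t) ≤ F t)
    (heq : ∫ t in convexHull ℝ (x '' (σ : Set (Fin n))), l' t * Real.exp (l t) =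
      (∫ t in convexHull ℝ (x '' (σ : Set (Fin n))), l t * Real.exp (l t)) -
      (∫ t in convexHull ℝ (x '' (σ : Set (Fin n))), Real.exp (l t)) +
      ∫ t in convexHull ℝ (x '' (σ : Set (Fin n))), F t) : l = l' := by
  by_contra hne
  have hl := continuous_affineMap l
  have hl' := continuous_affineMap l'
  have i1 := integrableOn_simplex (x := x) (σ := σ) (g := fun t => l t * Real.exp (l t))
    (hl.mul hl.rexp)
  have i2 := integrableOn_simplex (x := x) (σ := σ) hl.rexp
  have i3 := integrableOn_simplex (x := x) (σ := σ) (g := fun t => l' t * Real.exp (l t))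
    (hl'.mul hl.rexp)
  have hI : ∫ t in convexHull ℝ (x '' (σ : Set (Fin n))),
      (l t * Real.exp (l t) - Real.exp (l t) + F t - l' t * Real.exp (l t)) = 0 := by
    have i12 : IntegrableOn (fun t => l t * Real.exp (l t) - Real.exp (l t))
      (convexHull ℝ (x '' (σ : Set (Fin n)))) := i1.sub i2
    have i12F : IntegrableOn (fun t => l t * Real.exp (l t) - Real.exp (l t) + F t)
      (convexHull ℝ (x '' (σ : Set (Fin n)))) := i12.add hF
    rw [integral_sub i12F i3, integral_add i12 hF, integral_sub i1 i2, heq, sub_self]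
  have hlt : ∀ t ∈ convexHull ℝ (x '' (σ : Set (Fin n))), l t ≠ l' t →
      0 < l t * Real.exp (l t) - Real.exp (l t) + F t - l' t * Real.exp (l t) := by
    intro t ht hll
    have h1 := hle t ht
    have h2 := mul_lt_mul_of_pos_left (Real.add_one_lt_exp (sub_ne_zero.2 hll.symm))
      (Real.exp_pos (l t))
    rw [← Real.exp_add, add_sub_cancel] at h2
    nlinarith
  have hpos : 0 < ∫ t in convexHull ℝ (x '' (σ : Set (Fin n))),
      (l t * Real.exp (l t) - Real.exp (l t) + F t - l' t * Real.exp (l t)) := by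
    have hnull := volume_setOf_eq_eq_zero hne
    rw [setIntegral_pos_iff_support_of_nonneg_ae]
    · have hσ : 0 < volume (convexHull ℝ (x '' (σ : Set (Fin n)))) :=
        lt_of_lt_of_le (isOpen_interior.measure_pos volume
          (interior_convexHull_nonempty_iff_affineSpan_eq_top.2 hspan))
          (measure_mono interior_subset)
      rw [← measure_sdiff_null hnull] at hσ
      exact hσ.trans_le (measure_mono fun t ht => ⟨(hlt t ht.1 ht.2).ne', ht.1⟩)
    · have hae : ∀ᵐ t, l t ≠ l' t := by
        rw [ae_iff]
        simpa using hnull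
      filter_upwards [ae_restrict_mem (measurableSet_convexHull_image x _),
        ae_restrict_of_ae hae] with t ht hll
      exact (hlt t ht hll).le
    · exact ((i1.sub i2).add hF).sub i3
  exact hpos.ne' hI

end Simplex

/-! ### The weights as integrals and the resulting bound -/

namespace IsLinearizing

variable {x : Fin n → Pt d} {y : Fin n → ℝ} {Δ : Finset (Finset (Fin n))}

theorem setIntegral_hull (h : IsLinearizing x y Δ) {F : Pt d → ℝ} (hF : IntegrableOn F (hull x)) :
    ∫ t in hull x, F t =
      ∑ σ : Δ, ∫ t in convexHull ℝ (x '' ((σ : Finset (Fin n)) : Set (Fin n))), F t := by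
  have hF' := hF
  rw [← h.union] at hF' ⊢
  rw [integral_iUnion_ae (fun σ => (measurableSet_convexHull_image x _).nullMeasurableSet) ?_ hF',
    tsum_fintype]
  exact fun σ τ hστ => h.disjoint σ σ.2 τ τ.2 fun h => hστ (Subtype.ext h)

theorem weight_eq (h : IsLinearizing x y Δ) (k : Fin n) : weight x y Δ k =
    ∑ σ : Δ, if hk : k ∈ (σ : Finset (Fin n)) then
    ∫ t in convexHull ℝ (x '' ((σ : Finset (Fin n)) : Set (Fin n))),
      (simplexBasis (h.ind σ σ.2) (h.span σ σ.2)).coord ⟨k, hk⟩ t *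
        Real.exp (interp (simplexBasis (h.ind σ σ.2) (h.span σ σ.2)) (fun i => y i) t)
    else 0 := by
  rw [weight, Finset.sum_filter, ← Finset.sum_coe_sort]
  refine Finset.sum_congr rfl fun σ _ => ?_
  split_ifs with hk
  · exact weight_summand_eq_integral (h.ind σ σ.2) (h.span σ σ.2) y hk
  · rfl

theorem weight_nonneg (h : IsLinearizing x y Δ) (k : Fin n) : 0 ≤ weight x y Δ k := by
  rw [h.weight_eq]
  refine Finset.sum_nonneg fun σ _ => ?_
  split_ifs with hk
  · exact (integral_coord_mul_exp_pos _ _ _ _).le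
  · exact le_rfl

theorem weight_pos_iff (h : IsLinearizing x y Δ) (k : Fin n) : 0 < weight x y Δ k ↔ ∃ σ ∈ Δ, k ∈ σ := by
  constructor
  · intro hpos
    by_contra hcon
    push Not at hcon
    rw [h.weight_eq, Finset.sum_eq_zero] at hpos
    · exact hpos.false
    · intro σ _
      rw [dif_neg (hcon σ σ.2)]
  · rintro ⟨σ, hσ, hk⟩
    rw [h.weight_eq]
    refine Finset.sum_pos' (fun σ _ => ?_) ⟨⟨σ, hσ⟩, Finset.mem_univ _, ?_⟩
    · split_ifs with hk
      · exact (integral_coord_mul_exp_pos _ _ _ _).le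
      · exact le_rfl
    · rw [dif_pos hk]
      exact integral_coord_mul_exp_pos _ _ _ _

/-- Summing barycentric coordinates against `v` produces the interpolation of `v`, which turns the
linear objective into an integral against the tent density. -/
theorem linObj_weight (h : IsLinearizing x y Δ) (v : Fin n → ℝ) :
    linObj (weight x y Δ) v =
    ∑ σ : Δ, ∫ t in convexHull ℝ (x '' ((σ : Finset (Fin n)) : Set (Fin n))),
      interp (simplexBasis (h.ind σ σ.2) (h.span σ σ.2)) (fun i => v i) t *
        Real.exp (interp (simplexBasis (h.ind σ σ.2) (h.span σ σ.2)) (fun i => y i) t) := by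
  simp only [linObj, h.weight_eq, Finset.sum_mul]
  rw [Finset.sum_comm]
  refine Finset.sum_congr rfl fun σ _ => ?_
  set b := simplexBasis (h.ind σ σ.2) (h.span σ σ.2)
  set l := interp b fun i => y i
  have hsum := sum_dite_mem_smul (σ : Finset (Fin n)) (fun i =>
    ∫ t in convexHull ℝ (x '' ((σ : Finset (Fin n)) : Set (Fin n))),
      b.coord i t * Real.exp (l t)) v
  refine hsum.trans ?_
  simp only [interp_apply b fun i => v i, Finset.sum_mul]
  rw [integral_finsetSum]
  · refine Finset.sum_congr (by ext; simp) fun i _ => ?_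
    rw [smul_eq_mul, ← integral_mul_const]
    congr 1
    ext t
    ring
  · intro i _
    exact integrableOn_simplex (((continuous_affineMap _).mul continuous_const).mul
      (continuous_affineMap l).rexp)

theorem integral_exp_tent_eq (h : IsLinearizing x y Δ) :
    ∫ t in hull x, Real.exp (tent x y t) =
    ∑ σ : Δ, ∫ t in convexHull ℝ (x '' ((σ : Finset (Fin n)) : Set (Fin n))),
      Real.exp (interp (simplexBasis (h.ind σ σ.2) (h.span σ σ.2)) (fun i => y i) t) := by
  rw [h.setIntegral_hull (integrableOn_exp_tent x y)]
  refine Finset.sum_congr rfl fun σ _ => ?_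
  refine setIntegral_congr_fun (measurableSet_convexHull_image x _) fun t ht => ?_
  rw [h.tent_eq σ σ.2 t ht]

theorem sum_weight (h : IsLinearizing x y Δ) :
    ∑ k, weight x y Δ k = ∫ t in hull x, Real.exp (tent x y t) := by
  have h1 : ∑ k, weight x y Δ k = linObj (weight x y Δ) fun _ => 1 := by simp [linObj]
  rw [h1, h.linObj_weight, h.integral_exp_tent_eq]
  refine Finset.sum_congr rfl fun σ _ => ?_
  simp only [interp_apply _ fun _ => (1 : ℝ), mul_one, AffineBasis.sum_coord_apply_eq_one, one_mul]

/-- Bound for the linear objective at `v` by any `F` that dominates the exponential of the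
interpolation of `v` on the triangulation. -/
theorem linObj_le (h : IsLinearizing x y Δ) {v : Fin n → ℝ} {F : Pt d → ℝ}
    (hF : IntegrableOn F (hull x))
    (hle : ∀ (σ) (hσ : σ ∈ Δ), ∀ t ∈ convexHull ℝ (x '' (σ : Set (Fin n))),
      Real.exp (interp (simplexBasis (h.ind σ hσ) (h.span σ hσ)) (fun i => v i) t) ≤ F t) :
    linObj (weight x y Δ) v ≤ linObj (weight x y Δ) y -
      (∫ t in hull x, Real.exp (tent x y t)) + ∫ t in hull x, F t := by
  rw [h.linObj_weight, h.linObj_weight, h.integral_exp_tent_eq, h.setIntegral_hull hF,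
    ← Finset.sum_sub_distrib, ← Finset.sum_add_distrib]
  exact Finset.sum_le_sum fun σ _ => integral_mul_exp_sub_le _ _
    (hF.mono_set (convexHull_image_subset_hull x _)) (hle σ σ.2)

theorem eq_of_linObj_eq (h : IsLinearizing x y Δ) {v : Fin n → ℝ} {F : Pt d → ℝ}
    (hF : IntegrableOn F (hull x))
    (hle : ∀ (σ) (hσ : σ ∈ Δ), ∀ t ∈ convexHull ℝ (x '' (σ : Set (Fin n))),
      Real.exp (interp (simplexBasis (h.ind σ hσ) (h.span σ hσ)) (fun i => v i) t) ≤ F t)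
    (heq : linObj (weight x y Δ) v = linObj (weight x y Δ) y -
      (∫ t in hull x, Real.exp (tent x y t)) + ∫ t in hull x, F t) :
    ∀ σ ∈ Δ, ∀ k ∈ σ, v k = y k := by
  intro σ hσ k hk
  rw [h.linObj_weight, h.linObj_weight, h.integral_exp_tent_eq, h.setIntegral_hull hF,
    ← Finset.sum_sub_distrib, ← Finset.sum_add_distrib, Finset.sum_eq_sum_iff_of_le
      fun (σ : Δ) _ => integral_mul_exp_sub_le _ _
        (hF.mono_set (convexHull_image_subset_hull x _)) (hle σ σ.2)] at heq
  have hl := eq_of_integral_mul_exp_sub_eq (h.span σ hσ) _ _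
    (hF.mono_set (convexHull_image_subset_hull x _)) (hle σ hσ) (heq ⟨σ, hσ⟩ (Finset.mem_univ _))
  have := congrArg (fun l : Pt d →ᵃ[ℝ] ℝ => l (simplexBasis (h.ind σ hσ) (h.span σ hσ) ⟨k, hk⟩)) hl
  simpa only [interp_basis] using this.symm

end IsLinearizing

end LogConcaveMLE

namespace LogConcaveMLE

variable {d n : ℕ}

/-! ### Log-concave densities -/

theorem extLog_of_pos {f : Pt d → ℝ} {t : Pt d} (h : 0 < f t) :
    extLog f t = (Real.log (f t) : EReal) :=
  ENNReal.log_ofReal_of_pos h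

theorem extLog_of_nonpos {f : Pt d → ℝ} {t : Pt d} (h : f t ≤ 0) : extLog f t = ⊥ := by
  rw [extLog, ENNReal.log_ofReal, if_pos h]

theorem IsLogConcave.concaveOn_log {f : Pt d → ℝ} (hf : IsLogConcave f) :
    ConcaveOn ℝ {t | 0 < f t} fun t => Real.log (f t) := by
  have key : ∀ s ∈ {t | 0 < f t}, ∀ t ∈ {t | 0 < f t}, ∀ a b : ℝ, 0 ≤ a → 0 ≤ b → a + b = 1 →
      0 < f (a • s + b • t) ∧
        a * Real.log (f s) + b * Real.log (f t) ≤ Real.log (f (a • s + b • t)) := by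
    intro s hs t ht a b ha hb hab
    have h := hf s t a b ha hb hab
    rw [extLog_of_pos hs, extLog_of_pos ht, ← EReal.coe_mul, ← EReal.coe_mul,
      ← EReal.coe_add] at h
    have hpos : 0 < f (a • s + b • t) := by
      by_contra hn
      rw [extLog_of_nonpos (not_lt.1 hn), le_bot_iff] at h
      exact EReal.coe_ne_bot _ h
    rw [extLog_of_pos hpos, EReal.coe_le_coe_iff] at h
    exact ⟨hpos, h⟩
  exact ⟨fun s hs t ht a b ha hb hab => (key s hs t ht a b ha hb hab).1,
    fun s hs t ht a b ha hb hab => (key s hs t ht a b ha hb hab).2⟩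

section TentDensity

variable (x : Fin n → Pt d) (y : Fin n → ℝ)

theorem tentDensity_of_mem {t : Pt d} (ht : t ∈ hull x) :
    tentDensity x y t = Real.exp (tent x y t) := indicator_of_mem ht _

theorem tentDensity_of_notMem {t : Pt d} (ht : t ∉ hull x) : tentDensity x y t = 0 :=
  indicator_of_notMem ht _

theorem tentDensity_nonneg (t : Pt d) : 0 ≤ tentDensity x y t :=
  indicator_nonneg (fun _ _ => (Real.exp_pos _).le) _

theorem extLog_tentDensity_of_mem {t : Pt d} (ht : t ∈ hull x) :
    extLog (tentDensity x y) t = (tent x y t : EReal) := by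
  have h := tentDensity_of_mem x y ht
  rw [extLog_of_pos (by rw [h]; exact Real.exp_pos _), h, Real.log_exp]

theorem isLogConcave_tentDensity : IsLogConcave (tentDensity x y) := by
  have hbot : ∀ t, t ∉ hull x → extLog (tentDensity x y) t = ⊥ := fun t ht =>
    extLog_of_nonpos (tentDensity_of_notMem x y ht).le
  intro s t a b ha hb hab
  -- Zero coefficients are treated apart: with `0 · (-∞) = 0`, the left side need not be `-∞` when a
  -- point lies outside the polytope.
  rcases ha.eq_or_lt with rfl | ha'
  · obtain rfl : b = 1 := by simpa using hab
    simp
  rcases hb.eq_or_lt with rfl | hb'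
  · obtain rfl : a = 1 := by simpa using hab
    simp
  by_cases hs : s ∈ hull x
  swap
  · rw [hbot s hs, EReal.coe_mul_bot_of_pos ha', EReal.bot_add]
    exact bot_le
  by_cases ht : t ∈ hull x
  swap
  · rw [hbot t ht, EReal.coe_mul_bot_of_pos hb', EReal.add_bot]
    exact bot_le
  have hconc := concaveOn_tent x y
  rw [extLog_tentDensity_of_mem x y hs, extLog_tentDensity_of_mem x y ht,
    extLog_tentDensity_of_mem x y (hconc.1 hs ht ha hb hab), ← EReal.coe_mul, ← EReal.coe_mul,
    ← EReal.coe_add, EReal.coe_le_coe_iff]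
  exact hconc.2 hs ht ha hb hab

theorem integrable_tentDensity : Integrable (tentDensity x y) :=
  (integrable_indicator_iff (measurableSet_hull x)).2 (integrableOn_exp_tent x y)

theorem integral_tentDensity :
    ∫ t, tentDensity x y t = ∫ t in hull x, Real.exp (tent x y t) :=
  integral_indicator (measurableSet_hull x)

theorem ereal_coe_sum {ι : Type*} (s : Finset ι) (g : ι → ℝ) :
    ((∑ i ∈ s, g i : ℝ) : EReal) = ∑ i ∈ s, (g i : EReal) :=
  map_sum (⟨⟨fun r : ℝ => (r : EReal), EReal.coe_zero⟩, EReal.coe_add⟩ : ℝ →+ EReal) g s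

theorem logLikelihood_tentDensity {x : Fin n → Pt d} {y : Fin n → ℝ} (hy : IsRelevant x y)
    (w : Fin n → ℝ) : logLikelihood x w (tentDensity x y) = (linObj w y : EReal) := by
  rw [logLikelihood, linObj, ereal_coe_sum]
  refine Finset.sum_congr rfl fun i _ => ?_
  rw [extLog_tentDensity_of_mem x y (subset_convexHull ℝ _ (mem_range_self i)), hy i,
    EReal.coe_mul]

end TentDensity

theorem logLikelihood_eq_bot {x : Fin n → Pt d} {w : Fin n → ℝ} {f : Pt d → ℝ} {k : Fin n}
    (hk : 0 < w k) (hf : f (x k) ≤ 0) : logLikelihood x w f = ⊥ := by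
  rw [logLikelihood, ← Finset.add_sum_erase Finset.univ _ (Finset.mem_univ k),
    extLog_of_nonpos hf, EReal.coe_mul_bot_of_pos hk, EReal.bot_add]

/-- Where `w k = 0` both sides contribute `0`, so the conventional value of `Real.log` at a zero of
`f` does no harm. -/
theorem logLikelihood_eq_coe {x : Fin n → Pt d} {w : Fin n → ℝ} (hw : ∀ k, 0 ≤ w k)
    {f : Pt d → ℝ} (hf : ∀ k, 0 < w k → 0 < f (x k)) :
    logLikelihood x w f = (linObj w fun k => Real.log (f (x k)) : EReal) := by
  rw [logLikelihood, linObj, ereal_coe_sum]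
  refine Finset.sum_congr rfl fun k _ => ?_
  rcases (hw k).eq_or_lt with h | h
  · rw [← h]
    simp
  · rw [extLog_of_pos (hf k h), EReal.coe_mul]

/-! ### Optimality and uniqueness in the three problems -/

namespace IsLinearizing

variable {x : Fin n → Pt d} {y : Fin n → ℝ} {Δ : Finset (Finset (Fin n))}

theorem exp_interp_le_exp_tent (h : IsLinearizing x y Δ) (v : Fin n → ℝ) (σ) (hσ : σ ∈ Δ)
    (t) (ht : t ∈ convexHull ℝ (x '' (σ : Set (Fin n)))) :
    Real.exp (interp (simplexBasis (h.ind σ hσ) (h.span σ hσ)) (fun i => v i) t) ≤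
      Real.exp (tent x v t) :=
  Real.exp_le_exp.2 (interp_le_of_concaveOn (h.ind σ hσ) (h.span σ hσ) (concaveOn_tent x v)
    (fun _ => subset_convexHull ℝ _ (mem_range_self _)) (fun i => le_tent_self x v i) ht).2

theorem exp_interp_log_le (h : IsLinearizing x y Δ) {f : Pt d → ℝ} (hf : IsLogConcave f) {σ}
    (hσ : σ ∈ Δ) (hpos : ∀ k ∈ σ, 0 < f (x k)) {t}
    (ht : t ∈ convexHull ℝ (x '' (σ : Set (Fin n)))) :
    Real.exp (interp (simplexBasis (h.ind σ hσ) (h.span σ hσ))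
      (fun i => Real.log (f (x i))) t) ≤ f t := by
  obtain ⟨htpos, hle⟩ := interp_le_of_concaveOn (h.ind σ hσ) (h.span σ hσ) hf.concaveOn_log
    (fun i => hpos i i.2) (fun i => le_rfl) ht
  exact (Real.le_log_iff_exp_le htpos).1 hle

theorem exists_mem_simplex (h : IsLinearizing x y Δ) {t : Pt d} (ht : t ∈ hull x) :
    ∃ σ ∈ Δ, t ∈ convexHull ℝ (x '' (σ : Set (Fin n))) := by
  rw [← h.union] at ht
  obtain ⟨σ, hσ⟩ := mem_iUnion.1 ht
  exact ⟨σ, σ.2, hσ⟩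

/-- A log-concave density that takes the values of the tent density at the vertices of the
triangulation is the tent density. -/
theorem eq_tentDensity (h : IsLinearizing x y Δ) (hdim : affineSpan ℝ (range x) = ⊤)
    (hint : ∫ t, tentDensity x y t = 1) {f : Pt d → ℝ} (hf : f ∈ logConcaveDensities d)
    (hval : ∀ σ ∈ Δ, ∀ k ∈ σ, f (x k) = Real.exp (y k)) : f = tentDensity x y := by
  obtain ⟨hf0, hlc, hfi, hf1⟩ := hf
  have hpos : ∀ σ ∈ Δ, ∀ k ∈ σ, 0 < f (x k) := fun σ hσ k hk => by
    rw [hval σ hσ k hk]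
    exact Real.exp_pos _
  have hge : ∀ t ∈ hull x, Real.exp (tent x y t) ≤ f t := fun t ht => by
    obtain ⟨σ, hσ, htσ⟩ := h.exists_mem_simplex ht
    have hlog : (fun i : {i // i ∈ σ} => Real.log (f (x i))) = fun i : {i // i ∈ σ} => y i := by
      ext i
      rw [hval σ hσ i i.2, Real.log_exp]
    rw [h.tent_eq σ hσ t htσ, ← hlog]
    exact h.exp_interp_log_le hlc hσ (hpos σ hσ) htσ
  have hle : tentDensity x y ≤ f := fun t => by
    by_cases ht : t ∈ hull x
    · rw [tentDensity_of_mem x y ht]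
      exact hge t ht
    · rw [tentDensity_of_notMem x y ht]
      exact hf0 t
  have hae : tentDensity x y =ᵐ[volume] f :=
    (integral_eq_iff_of_ae_le (integrable_tentDensity x y) hfi
      (Filter.Eventually.of_forall hle)).1 (hint.trans hf1.symm)
  -- Almost everywhere equality excludes strict inequality on a nonempty open set. A single point of
  -- strict inequality is spread to such a set by concavity.
  have hopen : ∀ V : Set (Pt d), IsOpen V → V.Nonempty → ¬ ∀ v ∈ V, tentDensity x y v < f v := by
    intro V hV hne hlt
    refine (hV.measure_pos volume hne).ne' (measure_mono_null (fun v hv => ?_) hae)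
    exact (hlt v hv).ne
  have hconc := hlc.concaveOn_log
  by_contra hne
  obtain ⟨t, hne⟩ := Function.ne_iff.1 hne
  have htlt : tentDensity x y t < f t := lt_of_le_of_ne (hle t) hne.symm
  have htpos : 0 < f t := (tentDensity_nonneg x y t).trans_lt htlt
  by_cases ht : t ∈ hull x
  · rw [tentDensity_of_mem x y ht] at htlt
    obtain ⟨σ, hσ, htσ⟩ := h.exists_mem_simplex ht
    set l := interp (simplexBasis (h.ind σ hσ) (h.span σ hσ)) fun i => y i
    have hl : ∀ s ∈ convexHull ℝ (x '' (σ : Set (Fin n))), tent x y s = l s := h.tent_eq σ hσ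
    -- The open set consists of the midpoints of `t` and interior points `u` of `σ`. There `h` is
    -- affine and `log f` is concave, so strictness at `t` persists.
    refine hopen {v | (2 : ℝ) • v - t ∈ interior (convexHull ℝ (x '' (σ : Set (Fin n))))}
      (isOpen_interior.preimage (by fun_prop)) ?_ ?_
    · obtain ⟨u, hu⟩ := interior_convexHull_nonempty_iff_affineSpan_eq_top.2 (h.span σ hσ)
      refine ⟨(2 : ℝ)⁻¹ • (t + u), ?_⟩
      have : (2 : ℝ) • (2 : ℝ)⁻¹ • (t + u) - t = u := by
        rw [smul_smul]
        norm_num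
      rwa [mem_ofPred_eq, this]
    · intro v hv
      set u := (2 : ℝ) • v - t with hu
      have hvu : v = (2⁻¹ : ℝ) • t + (2⁻¹ : ℝ) • u := by
        rw [hu]
        module
      have hhalf : (2⁻¹ : ℝ) + 2⁻¹ = 1 := by norm_num
      have h0 : (0 : ℝ) ≤ 2⁻¹ := by norm_num
      have huσ := interior_subset hv
      have huP := convexHull_image_subset_hull x _ huσ
      have hvσ : v ∈ convexHull ℝ (x '' (σ : Set (Fin n))) := by
        rw [hvu]
        exact convex_convexHull ℝ _ htσ huσ h0 h0 hhalf
      have hupos : 0 < f u := (Real.exp_pos _).trans_le (hge u huP)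
      have h1 := hconc.2 htpos hupos h0 h0 hhalf
      have hvpos := hconc.1 htpos hupos h0 h0 hhalf
      have h2 : l v = 2⁻¹ * l t + 2⁻¹ * l u := by
        conv_lhs => rw [hvu]
        exact Convex.combo_affine_apply hhalf
      rw [← hvu] at h1 hvpos
      simp only [smul_eq_mul] at h1
      have h3 := (Real.lt_log_iff_exp_lt htpos).2 htlt
      have h4 := (Real.le_log_iff_exp_le hupos).2 (hge u huP)
      rw [hl t htσ] at h3
      rw [hl u huσ] at h4
      rw [tentDensity_of_mem x y (convexHull_image_subset_hull x _ hvσ), hl v hvσ,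
        ← Real.lt_log_iff_exp_lt hvpos]
      linarith
  · obtain ⟨u₀, hu₀⟩ := interior_hull_nonempty hdim
    have hc : Filter.Tendsto (fun ε : ℝ => (1 - ε) • t + ε • u₀) (nhdsWithin 0 (Ioi 0))
        (nhds t) := by
      have hcont : Continuous fun ε : ℝ => (1 - ε) • t + ε • u₀ := by fun_prop
      have := hcont.tendsto 0
      simp only [sub_zero, one_smul, zero_smul, add_zero] at this
      exact this.mono_left nhdsWithin_le_nhds
    have hlt1 : ∀ᶠ ε : ℝ in nhdsWithin 0 (Ioi 0), ε < 1 :=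
      nhdsWithin_le_nhds (gt_mem_nhds one_pos)
    obtain ⟨ε, ⟨hεP, hε1⟩, hε0⟩ := (((hc.eventually
      ((isClosed_hull x).isOpen_compl.mem_nhds ht)).and hlt1).and self_mem_nhdsWithin).exists
    replace hε0 : 0 < ε := hε0
    -- If `f` is positive at a point `t` off the polytope, it is positive on all segments from `t`
    -- into the interior; their points at parameter `ε` that lie outside the polytope form this open
    -- set.
    refine hopen ((hull x)ᶜ ∩ {v | ε⁻¹ • (v - (1 - ε) • t) ∈ interior (hull x)})
      ((isClosed_hull x).isOpen_compl.inter (isOpen_interior.preimage (by fun_prop))) ?_ ?_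
    · refine ⟨(1 - ε) • t + ε • u₀, hεP, ?_⟩
      rwa [mem_ofPred_eq, add_sub_cancel_left, smul_smul, inv_mul_cancel₀ hε0.ne', one_smul]
    · rintro v ⟨hvP, hv⟩
      rw [tentDensity_of_notMem x y hvP]
      have hupos := (Real.exp_pos _).trans_le (hge _ (interior_subset hv))
      have := hconc.1 htpos hupos (sub_nonneg.2 hε1.le) hε0.le (sub_add_cancel 1 ε)
      rwa [smul_smul, mul_inv_cancel₀ hε0.ne', one_smul, add_sub_cancel] at this

theorem isUniqueMaximizer_logLikelihood (h : IsLinearizing x y Δ)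
    (hdim : affineSpan ℝ (range x) = ⊤) (hy : IsRelevant x y)
    (hint : ∫ t, tentDensity x y t = 1) :
    IsUniqueMaximizer (logLikelihood x (weight x y Δ)) (logConcaveDensities d)
      (tentDensity x y) := by
  refine ⟨⟨tentDensity_nonneg x y, isLogConcave_tentDensity x y, integrable_tentDensity x y, hint⟩,
    fun f hf hne => ?_⟩
  rw [logLikelihood_tentDensity hy]
  by_cases hpos : ∀ k, 0 < weight x y Δ k → 0 < f (x k)
  swap
  · push Not at hpos
    obtain ⟨k, hk, hfk⟩ := hpos
    rw [logLikelihood_eq_bot hk hfk]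
    exact EReal.bot_lt_coe _
  rw [logLikelihood_eq_coe h.weight_nonneg hpos, EReal.coe_lt_coe_iff]
  have hposσ : ∀ σ ∈ Δ, ∀ k ∈ σ, 0 < f (x k) := fun σ hσ k hk =>
    hpos k ((h.weight_pos_iff k).2 ⟨σ, hσ, hk⟩)
  have hdom := fun σ hσ t ht => h.exp_interp_log_le hf.2.1 (σ := σ) hσ (hposσ σ hσ) (t := t) ht
  have hle := h.linObj_le (v := fun k => Real.log (f (x k))) hf.2.2.1.integrableOn hdom
  -- Mass of `f` outside the polytope only lowers the upper bound for its likelihood.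
  have hfP : ∫ t in hull x, f t ≤ 1 :=
    (setIntegral_le_integral hf.2.2.1 (Filter.Eventually.of_forall hf.1)).trans hf.2.2.2.le
  rw [integral_tentDensity] at hint
  refine lt_of_le_of_ne (by linarith) fun heq => hne ?_
  have hval := h.eq_of_linObj_eq (v := fun k => Real.log (f (x k))) hf.2.2.1.integrableOn hdom
    (by linarith)
  refine h.eq_tentDensity hdim (by rw [integral_tentDensity, hint]) hf fun σ hσ k hk => ?_
  rw [← hval σ hσ k hk, Real.exp_log (hposσ σ hσ k hk)]

theorem linObj_le_of_tent (h : IsLinearizing x y Δ) (v : Fin n → ℝ) :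
    linObj (weight x y Δ) v ≤ linObj (weight x y Δ) y -
      (∫ t in hull x, Real.exp (tent x y t)) + ∫ t in hull x, Real.exp (tent x v t) :=
  h.linObj_le (integrableOn_exp_tent x v) (h.exp_interp_le_exp_tent v)

theorem eq_of_linObj_eq_of_tent (h : IsLinearizing x y Δ) (huse : ∀ k, ∃ σ ∈ Δ, k ∈ σ)
    {v : Fin n → ℝ} (heq : linObj (weight x y Δ) v = linObj (weight x y Δ) y -
      (∫ t in hull x, Real.exp (tent x y t)) + ∫ t in hull x, Real.exp (tent x v t)) :
    v = y := by
  ext k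
  obtain ⟨σ, hσ, hk⟩ := huse k
  exact h.eq_of_linObj_eq (integrableOn_exp_tent x v) (h.exp_interp_le_exp_tent v) heq σ hσ k hk

theorem isTheOptimum (h : IsLinearizing x y Δ) (hdim : affineSpan ℝ (range x) = ⊤)
    (hy : IsRelevant x y) (hint : ∫ t, tentDensity x y t = 1) (huse : ∀ k, ∃ σ ∈ Δ, k ∈ σ) :
    IsTheOptimum x (weight x y Δ) y := by
  refine ⟨h.isUniqueMaximizer_logLikelihood hdim hy hint, ⟨?_, fun v hv hne => ?_⟩,
    mem_univ _, fun v _ hne => ?_⟩ <;> rw [integral_tentDensity] at hint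
  · exact hint.le
  · have hle := h.linObj_le_of_tent v
    replace hv : ∫ t in hull x, Real.exp (tent x v t) ≤ 1 := hv
    refine lt_of_le_of_ne (by linarith) fun heq => hne ?_
    exact h.eq_of_linObj_eq_of_tent huse (by linarith)
  · have hle := h.linObj_le_of_tent v
    unfold unconstrainedObj
    refine lt_of_le_of_ne (by linarith) fun heq => hne ?_
    exact h.eq_of_linObj_eq_of_tent huse (by linarith)

end IsLinearizing

end LogConcaveMLE

open LogConcaveMLE

theorem lemma3p4 {d n : ℕ} (x : Fin n → Pt d) (hx : Function.Injective x)
    (hdim : affineSpan ℝ (Set.range x) = ⊤)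
    (y : Fin n → ℝ) (hy : IsRelevant x y) (hint : ∫ t, tentDensity x y t = 1) :
    -- there are positive weights for which `y` is the optimal solution
    (∃ w : Fin n → ℝ, (∀ k, 0 < w k) ∧ ∑ k, w k = 1 ∧ IsTheOptimum x w y) ∧
    -- some regular triangulation that refines the subdivision induced by `y` uses every point
    (∃ Δ : Finset (Finset (Fin n)), IsRegularTriangulation x Δ ∧
      Refines Δ (regularSubdivision x y) ∧ ∀ k, ∃ σ ∈ Δ, k ∈ σ) ∧
    -- the explicit weights, for every regular triangulation that refines that subdivision
    (∀ Δ : Finset (Finset (Fin n)), IsRegularTriangulation x Δ →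
      Refines Δ (regularSubdivision x y) →
        (∀ k, 0 ≤ weight x y Δ k) ∧
        (∀ k, 0 < weight x y Δ k ↔ ∃ σ ∈ Δ, k ∈ σ) ∧
        ∑ k, weight x y Δ k = 1 ∧
        IsUniqueMaximizer (logLikelihood x (weight x y Δ)) (logConcaveDensities d)
          (tentDensity x y) ∧
        IsMaximizer (linObj (weight x y Δ)) (samworthBody x) y ∧
        IsMaximizer (unconstrainedObj x (weight x y Δ)) Set.univ y ∧
        ((∀ k, ∃ σ ∈ Δ, k ∈ σ) → IsTheOptimum x (weight x y Δ) y)) := by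
  have hint' := hint
  rw [integral_tentDensity] at hint'
  obtain ⟨Δ, hΔ, href, huse⟩ := exists_regularTriangulation_refines hx hdim hy
  refine ⟨⟨weight x y Δ, ?_⟩, ⟨Δ, hΔ, href, huse⟩, fun Δ hΔ href => ?_⟩
  · have h := hΔ.isLinearizing hdim hy href
    exact ⟨fun k => (h.weight_pos_iff k).2 (huse k), h.sum_weight.trans hint',
      h.isTheOptimum hdim hy hint huse⟩
  · have h := hΔ.isLinearizing hdim hy href
    refine ⟨h.weight_nonneg, h.weight_pos_iff, h.sum_weight.trans hint',
      h.isUniqueMaximizer_logLikelihood hdim hy hint, ⟨hint'.le, fun v hv => ?_⟩,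
      ⟨Set.mem_univ _, fun v _ => ?_⟩, h.isTheOptimum hdim hy hint⟩
    · have hle := h.linObj_le_of_tent v
      replace hv : ∫ t in hull x, Real.exp (tent x v t) ≤ 1 := hv
      linarith
    · have hle := h.linObj_le_of_tent v
      unfold unconstrainedObj
      linarith
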